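/- **Conventions.** Clauses are nonempty finite disjunctions of possibly negated atoms $p(t)$, $r(s,t)$, $s=t$, where $p$ is a unary and $r$ a binary predicate and the terms $s,t$ are variables or constants (no function symbols); their variables are universally quantified. Semantics is classical first-order semantics with true equality under the Unique Name Assumption: distinct constants denote distinct elements. Entailment and consistency refer to such interpretations. *DL clause.* A clause $C$ is a DL clause if (p2) it contains a binary literal, or it is ground, or it contains no constants, no (in)equalities and exactly one variable; (p3) if it contains a binary literal, then each of its variables occurs in a binary literal; (p4) if it contains a positive binary literal $B$, then all remaining literals are negative binary literals, and together they have the same set of variables as $B$. *Reduced form.* A unary predicate $p$ occurring in $S$ is a top predicate of $S$ if $S\models\forall x\,p(x)$. The reduced form of $S$ arises by deleting every clause that contains a positive literal with a top predicate and deleting all negated literals with a top predicate from the remaining clauses. "$S$ is in reduced form" means that $S$ is the reduced form of a set of DL clauses. *Conjunctive query.* A finite conjunction of possibly negated unary atoms and of positive binary atoms. *The program.* For a literal $L$ let $\mathrm{can}(L)$ be $L$ with $\neg p$, $\neg r$ replaced by new predicate names $\mathtt{not\_}p$, $\mathtt{not\_}r$, and $\neg(s=t)$ by $\mathtt{dif}(s,t)$.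 $\mathit{PDL}(S)$ consists of all Horn clauses $\mathrm{can}(L_k)\leftarrow \mathrm{can}(\neg L_i)\ (i\neq k)$ for $L_1\vee\dots\vee L_n\in S$ with $L_k$ a possibly negated unary or binary atom (double negations being removed). A body satisfies the binary-first rule if (1) each binary goal precedes all unary and (in)equality goals that share a variable with it, and (2) whenever a binary goal of the body contains a head variable, at least one such goal precedes all unary goals. $P$ is a finite list, in any order, of the clauses of $\mathit{PDL}(S)$ with no negated binary head, with their bodies ordered by the binary-first rule and $=$, $\mathtt{dif}$ replaced by the term comparisons $\mathtt{==}$, $\mathtt{\backslash{=}{=}}$. *The engine.* Standard Prolog execution (leftmost goal first, clauses in program order, depth-first search with backtracking), in which every goal carries the list of its ancestor goals, newest first, extended as follows. (1) Loop elimination: a goal identical to one of its ancestors fails. (2) Deterministic ancestor resolution for unary goals only: the goal may succeed by unifying its negated version ($\mathtt{not\_}p(t)$ for $p(t)$ and vice versa) with the first ancestor for which this is possible, no other ancestor being tried; on backtracking, the program clauses are tried too. An answer is the tuple of the values of the variables of the query in a successful branch. **Theorem (soundness and completeness of the DLog execution).** Let $S$ be a finite consistent set of DL clauses in reduced form, $Q$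 a conjunctive query, and $P$ a program obtained from $S$ as above. Then the engine invoked with $P$ and $Q$ terminates. The ground instances of the answers it returns are exactly the ground instantiations of the variables of $Q$ for which $Q$ is entailed by $S$. Moreover, if $Q$ has no conjunct $\neg p(t)$ with $S\models\forall x\,\neg p(x)$, then all returned answers are ground, so that the answers returned are exactly the ground instantiations of the variables of $Q$ for which $Q$ is entailed by $S$. -/

import Mathlib

universe u v w

namespace DLog

/-! ## Function-free first-order clauses

`K`, `R`, `I` are the types of concept names (unary predicates), role names (binary predicates)
and individual names (constants). -/

/-- Function-free terms: variables and constants. -/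
inductive Term (I : Type w) where
  | var (x : ℕ)
  | const (a : I)
  deriving DecidableEq

/-- Atomic formulas `p(t)`, `r(s,t)` and `s = t`. -/
inductive Atom (K : Type u) (R : Type v) (I : Type w) where
  | unary (p : K) (t : Term I)
  | binary (r : R) (s t : Term I)
  | eq (s t : Term I)

/-- A literal: an atom (`pos = true`) or a negated atom (`pos = false`). -/
structure Literal (K : Type u) (R : Type v) (I : Type w) where
  pos : Bool
  atom : Atom K R I

/-- A clause is the (universally quantified) disjunction of the literals in a list. -/
abbrev Clause (K : Type u) (R : Type v) (I : Type w) := List (Literal K R I)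

/-- Substitutions of terms for variables. -/
abbrev Subst (I : Type w) := ℕ → Term I

section Logic

variable {K : Type u} {R : Type v} {I : Type w}

def Term.subst (θ : Subst I) : Term I → Term I
  | .var x => θ x
  | .const a => .const a

def Term.vars : Term I → List ℕ
  | .var x => [x]
  | .const _ => []

def Atom.args : Atom K R I → List (Term I)
  | .unary _ t => [t]
  | .binary _ s t => [s, t]
  | .eq s t => [s, t]

def Atom.subst (θ : Subst I) : Atom K R I → Atom K R I
  | .unary p t => .unary p (t.subst θ)
  | .binary r s t => .binary r (s.subst θ) (t.subst θ)
  | .eq s t => .eq (s.subst θ) (t.subst θ)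

def Literal.subst (θ : Subst I) (L : Literal K R I) : Literal K R I :=
  ⟨L.pos, L.atom.subst θ⟩

/-- The complementary literal (with double negations removed). -/
def Literal.neg (L : Literal K R I) : Literal K R I := ⟨!L.pos, L.atom⟩

def Literal.vars (L : Literal K R I) : List ℕ := L.atom.args.flatMap Term.vars

/-- The variables of a list of literals, without repetition. -/
def litVars (C : List (Literal K R I)) : List ℕ := (C.flatMap Literal.vars).dedup

def Literal.IsUnary (L : Literal K R I) : Prop := ∃ p t, L.atom = .unary p t

def Literal.IsBinary (L : Literal K R I) : Prop := ∃ r s t, L.atom = .binary r s t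

def Literal.IsEq (L : Literal K R I) : Prop := ∃ s t, L.atom = .eq s t

/-- Interpretations under the Unique Name Assumption: distinct constants denote distinct
elements; equality is interpreted as identity. -/
structure Interp (K : Type u) (R : Type v) (I : Type w) where
  Dom : Type w
  nonempty : Nonempty Dom
  const : I → Dom
  const_injective : Function.Injective const
  concept : K → Dom → Prop
  role : R → Dom → Dom → Prop

def Interp.term (M : Interp K R I) (val : ℕ → M.Dom) : Term I → M.Dom
  | .var x => val x
  | .const a => M.const a

def Interp.AtomHolds (M : Interp K R I) (val : ℕ → M.Dom) : Atom K R I → Prop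
  | .unary p t => M.concept p (M.term val t)
  | .binary r s t => M.role r (M.term val s) (M.term val t)
  | .eq s t => M.term val s = M.term val t

def Interp.LitHolds (M : Interp K R I) (val : ℕ → M.Dom) (L : Literal K R I) : Prop :=
  if L.pos then M.AtomHolds val L.atom else ¬ M.AtomHolds val L.atom

/-- `M` satisfies the universal closure of the disjunction `C`. -/
def Interp.SatClause (M : Interp K R I) (C : Clause K R I) : Prop :=
  ∀ val : ℕ → M.Dom, ∃ L ∈ C, M.LitHolds val L

def Interp.IsModel (M : Interp K R I) (S : Set (Clause K R I)) : Prop :=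
  ∀ C ∈ S, M.SatClause C

/-- `S` has a model (under the Unique Name Assumption). -/
def Consistent (S : Set (Clause K R I)) : Prop :=
  ∃ M : Interp K R I, M.IsModel S

/-- `S` entails the universal closure of the clause `C`. -/
def Entails (S : Set (Clause K R I)) (C : Clause K R I) : Prop :=
  ∀ M : Interp K R I, M.IsModel S → M.SatClause C

/-- `S` entails (the universal closure of) the conjunction of the literals in `Q`. -/
def EntailsConj (S : Set (Clause K R I)) (Q : List (Literal K R I)) : Prop :=
  ∀ M : Interp K R I, M.IsModel S → ∀ val : ℕ → M.Dom, ∀ L ∈ Q, M.LitHolds val L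

/-! ## DL clauses and reduced form -/

/-- DL clauses. Property (p1), that all literals are function-free unary, binary or equality
literals, is built into the type of literals. -/
structure IsDLClause (C : Clause K R I) : Prop where
  ne_nil : C ≠ []
  /-- (p2): `C` contains a binary literal, or is ground, or contains no constants, no
  (in)equalities and exactly one variable. -/
  p2 : (∃ L ∈ C, L.IsBinary) ∨ litVars C = [] ∨
    ((∀ L ∈ C, (∀ t ∈ L.atom.args, ∃ x, t = .var x) ∧ ¬ L.IsEq) ∧ (litVars C).length = 1)
  /-- (p3): if there is a binary literal, each variable occurs in a binary literal. -/
  p3 : (∃ L ∈ C, L.IsBinary) → ∀ x ∈ litVars C, ∃ L ∈ C, L.IsBinary ∧ x ∈ L.vars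
  /-- (p4): if `B` is a positive binary literal of `C`, the remaining literals are negative
  binary ones, and they have the same set of variables as `B`. -/
  p4 : ∀ l₁ B l₂, C = l₁ ++ B :: l₂ → B.IsBinary → B.pos = true →
    (∀ L ∈ l₁ ++ l₂, L.IsBinary ∧ L.pos = false) ∧
      ∀ x, x ∈ litVars (l₁ ++ l₂) ↔ x ∈ B.vars

/-- `p` is a top predicate of `S`: it occurs in `S`, and `S` entails `∀ x, p(x)`. -/
def IsTop (S : Set (Clause K R I)) (p : K) : Prop :=
  (∃ C ∈ S, ∃ L ∈ C, ∃ t, L.atom = .unary p t) ∧ Entails S [⟨true, .unary p (.var 0)⟩]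

/-- The predicate of the literal `L` is a top predicate of `S`. -/
def Literal.RefersToTop (S : Set (Clause K R I)) (L : Literal K R I) : Prop :=
  ∃ p t, L.atom = .unary p t ∧ IsTop S p

open Classical in
/-- The reduced form of `S`: negated literals with a top predicate are deleted from the clauses,
and clauses containing a positive literal with a top predicate are deleted from the set. -/
noncomputable def reducedForm (S : Set (Clause K R I)) : Set (Clause K R I) :=
  {C' | ∃ C ∈ S, (∀ L ∈ C, L.pos = true → ¬ L.RefersToTop S) ∧
    C' = C.filter (fun L => ¬ (L.pos = false ∧ L.RefersToTop S))}

/-- `S` is the reduced form of a set of DL clauses. -/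
def InReducedForm (S : Set (Clause K R I)) : Prop :=
  ∃ S₀ : Set (Clause K R I), (∀ C ∈ S₀, IsDLClause C) ∧ S = reducedForm S₀

/-- A conjunctive query: a conjunction of possibly negated unary and of positive binary
literals. -/
def IsConjunctiveQuery (Q : List (Literal K R I)) : Prop :=
  ∀ L ∈ Q, L.IsUnary ∨ (L.IsBinary ∧ L.pos = true)

end Logic

/-! ## Prolog programs -/

/-- Prolog predicate names: for each name `a` there is a further name `not_a`. -/
inductive PName (α : Type u) where
  | plain (a : α)
  | not_ (a : α)
  deriving DecidableEq

/-- The built-in predicates `=` and `dif`. -/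
inductive EqPred where
  | unify
  | dif
  deriving DecidableEq

/-- The built-in comparison predicates `==` and `\==`. -/
inductive CmpPred where
  | ident
  | nident
  deriving DecidableEq

/-- Prolog goals; `E` is the type of the available built-in (in)equality predicates. -/
inductive Goal (E : Type) (K : Type u) (R : Type v) (I : Type w) where
  | unary (p : PName K) (t : Term I)
  | binary (r : PName R) (s t : Term I)
  | test (e : E) (s t : Term I)
  deriving DecidableEq

/-- The Horn clause `head :- body`. -/
structure HornClause (E : Type) (K : Type u) (R : Type v) (I : Type w) where
  head : Goal E K R I
  body : List (Goal E K R I)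

section Program

variable {E : Type} {K : Type u} {R : Type v} {I : Type w}

/-- The predicate name with the prefix `not_` removed if present, and added otherwise. -/
def PName.neg {α : Type u} : PName α → PName α
  | .plain a => .not_ a
  | .not_ a => .plain a

def Goal.args : Goal E K R I → List (Term I)
  | .unary _ t => [t]
  | .binary _ s t => [s, t]
  | .test _ s t => [s, t]

def Goal.vars (g : Goal E K R I) : List ℕ := g.args.flatMap Term.vars

def Goal.IsUnary (g : Goal E K R I) : Prop := ∃ p t, g = .unary p t

def Goal.IsBinary (g : Goal E K R I) : Prop := ∃ r s t, g = .binary r s t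

def Goal.IsNegBinary (g : Goal E K R I) : Prop := ∃ r s t, g = .binary (.not_ r) s t

/-- The canonical form of a literal. -/
def Literal.can : Literal K R I → Goal EqPred K R I
  | ⟨true, .unary p t⟩ => .unary (.plain p) t
  | ⟨false, .unary p t⟩ => .unary (.not_ p) t
  | ⟨true, .binary r s t⟩ => .binary (.plain r) s t
  | ⟨false, .binary r s t⟩ => .binary (.not_ r) s t
  | ⟨true, .eq s t⟩ => .test .unify s t
  | ⟨false, .eq s t⟩ => .test .dif s t

/-- Replacement of `=` by `==` and of `dif` by `\==`. -/
def Goal.toCmp : Goal EqPred K R I → Goal CmpPred K R I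
  | .unary p t => .unary p t
  | .binary r s t => .binary r s t
  | .test .unify s t => .test .ident s t
  | .test .dif s t => .test .nident s t

/-- `c` is a DL-contrapositive of `C`: its head is `can(L)` for a unary or binary literal `L`
of `C`, and its body is obtained from the negations of the other literals. -/
def IsContrapositive (C : Clause K R I) (c : HornClause EqPred K R I) : Prop :=
  ∃ l₁ L l₂, C = l₁ ++ L :: l₂ ∧ ¬ L.IsEq ∧
    c = ⟨L.can, (l₁ ++ l₂).map fun L' => L'.neg.can⟩

/-- The DL program `PDL(S)`. -/
def PDL (S : Set (Clause K R I)) : Set (HornClause EqPred K R I) :=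
  {c | ∃ C ∈ S, IsContrapositive C c}

/-- The body of `c` is ordered according to the binary-first rule:
(1) no unary or (in)equality goal stands before a binary goal with which it shares a variable;
(2) if a head variable occurs in a binary goal of the body, then at least one such goal precedes
all unary goals. -/
def BinaryFirst (c : HornClause E K R I) : Prop :=
  c.body.Pairwise (fun g h => ¬ g.IsBinary → h.IsBinary → ∀ x ∈ g.vars, x ∉ h.vars) ∧
  ∀ x ∈ c.head.vars, (∃ g ∈ c.body, g.IsBinary ∧ x ∈ g.vars) →
    ∃ l₁ g l₂, c.body = l₁ ++ g :: l₂ ∧ g.IsBinary ∧ x ∈ g.vars ∧ ∀ h ∈ l₁, ¬ h.IsUnary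

/-- `c` arises from `d` by reordering the body according to the binary-first rule and replacing
`=` and `dif` by `==` and `\==`. -/
def IsOrdering (d : HornClause EqPred K R I) (c : HornClause CmpPred K R I) : Prop :=
  c.head = d.head.toCmp ∧ c.body.Perm (d.body.map Goal.toCmp) ∧ BinaryFirst c

/-- `P` is obtained from `PDL(S)` by removing the clauses with negated binary heads, ordering
the bodies according to the binary-first rule, and replacing `=` and `dif` by `==` and `\==`.
The clauses of `P` may come in any order. -/
def IsDLogProgram (S : Set (Clause K R I)) (P : List (HornClause CmpPred K R I)) : Prop :=
  (∀ c ∈ P, ∃ d ∈ PDL S, ¬ d.head.IsNegBinary ∧ IsOrdering d c) ∧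
  (∀ d ∈ PDL S, ¬ d.head.IsNegBinary → ∃ c ∈ P, IsOrdering d c)

end Program

/-! ## The extended Prolog engine -/

section Engine

variable {K : Type u} {R : Type v} {I : Type w}

def Goal.subst (θ : Subst I) : Goal CmpPred K R I → Goal CmpPred K R I
  | .unary p t => .unary p (t.subst θ)
  | .binary r s t => .binary r (s.subst θ) (t.subst θ)
  | .test e s t => .test e (s.subst θ) (t.subst θ)

/-- The negated version of a goal. -/
def Goal.neg : Goal CmpPred K R I → Goal CmpPred K R I
  | .unary p t => .unary p.neg t
  | .binary r s t => .binary r.neg s t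
  | .test .ident s t => .test .nident s t
  | .test .nident s t => .test .ident s t

/-- The substitution that replaces `x` by `t`. -/
def Subst.single (x : ℕ) (t : Term I) : Subst I := fun y => if y = x then t else .var y

/-- Most general unifier of two terms. -/
def Term.mgu [DecidableEq I] : Term I → Term I → Option (Subst I)
  | .var x, t => some (Subst.single x t)
  | .const a, .var y => some (Subst.single y (.const a))
  | .const a, .const b => if a = b then some Term.var else none

/-- Most general unifier of two calls. -/
def Goal.mgu [DecidableEq K] [DecidableEq R] [DecidableEq I] :
    Goal CmpPred K R I → Goal CmpPred K R I → Option (Subst I)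
  | .unary p s, .unary q t => if p = q then s.mgu t else none
  | .binary p s s', .binary q t t' =>
      if p = q then
        (s.mgu t).bind fun θ =>
          ((s'.subst θ).mgu (t'.subst θ)).map fun η => fun x => (θ x).subst η
      else none
  | _, _ => none

/-- An upper bound (exclusive) of the variables in a list of goals. -/
def varBound (gs : List (Goal CmpPred K R I)) : ℕ :=
  ((gs.flatMap Goal.vars).map (· + 1)).foldr max 0

/-- The clause with its variables shifted by `k`. -/
def HornClause.rename (k : ℕ) (c : HornClause CmpPred K R I) : HornClause CmpPred K R I :=
  ⟨c.head.subst fun x => .var (x + k), c.body.map (Goal.subst fun x => .var (x + k))⟩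

/-- A node of the search tree: the goals still to be solved, from left to right, each with the
list of its ancestors (newest first); the current values of the query variables; and a number
beyond all variables in use. -/
structure Frame (K : Type u) (R : Type v) (I : Type w) where
  goals : List (Goal CmpPred K R I × List (Goal CmpPred K R I))
  answer : List (Term I)
  fresh : ℕ

def Frame.subst (θ : Subst I) (f : Frame K R I) : Frame K R I :=
  ⟨f.goals.map fun ga => (ga.1.subst θ, ga.2.map (Goal.subst θ)), f.answer.map (Term.subst θ),
    f.fresh⟩

variable [DecidableEq K] [DecidableEq R] [DecidableEq I]

/-- `s == t` and `s \== t`. -/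
def CmpPred.eval : CmpPred → Term I → Term I → Bool
  | .ident, s, t => decide (s = t)
  | .nident, s, t => decide (s ≠ t)

/-- Deterministic ancestor resolution, for unary goals only: `g` succeeds by unification with
the negation of the first ancestor for which this is possible; other ancestors are not tried. -/
def ancestorStep (g : Goal CmpPred K R I) (anc : List (Goal CmpPred K R I))
    (f : Frame K R I) : List (Frame K R I) :=
  match g with
  | .unary _ _ => ((anc.findSome? fun a => g.neg.mgu a).map fun θ => f.subst θ).toList
  | _ => []

/-- Resolution of `g` with a renamed copy of the program clause `c`. -/
def clauseStep (g : Goal CmpPred K R I) (anc : List (Goal CmpPred K R I))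
    (f : Frame K R I) (c : HornClause CmpPred K R I) : Option (Frame K R I) :=
  let c' := c.rename f.fresh
  (g.mgu c'.head).map fun θ =>
    Frame.subst θ ⟨c'.body.map (fun b => (b, g :: anc)) ++ f.goals, f.answer,
      f.fresh + varBound (c.head :: c.body)⟩

/-- The alternatives, in the order in which they are tried, for solving the goal `g` with
ancestor list `anc`, where `f` holds the remaining goals. A goal which is identical to one of its
ancestors fails (loop elimination); otherwise ancestor resolution is tried first, and then the
program clauses in program order. -/
def alternatives (P : List (HornClause CmpPred K R I)) (g : Goal CmpPred K R I)
    (anc : List (Goal CmpPred K R I)) (f : Frame K R I) : List (Frame K R I) :=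
  match g with
  | .test e s t => if e.eval s t then [f] else []
  | _ => if g ∈ anc then [] else ancestorStep g anc f ++ P.filterMap (clauseStep g anc f)

/-- A state of the engine: the stack of alternatives yet to be explored, and the answers found so
far. The engine has terminated when the stack is empty. -/
structure EngineState (K : Type u) (R : Type v) (I : Type w) where
  stack : List (Frame K R I)
  answers : List (List (Term I))

/-- One step of the depth-first execution of the program `P`. -/
def engineStep (P : List (HornClause CmpPred K R I)) : EngineState K R I → EngineState K R I
  | ⟨[], A⟩ => ⟨[], A⟩
  | ⟨⟨[], ans, _⟩ :: fs, A⟩ => ⟨fs, A ++ [ans]⟩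
  | ⟨⟨(g, anc) :: gs, ans, n⟩ :: fs, A⟩ => ⟨alternatives P g anc ⟨gs, ans, n⟩ ++ fs, A⟩

/-- The state in which the engine is invoked with the query `Q`. -/
def initialState (Q : List (Literal K R I)) : EngineState K R I :=
  let gs := Q.map fun L => L.can.toCmp
  ⟨[⟨gs.map fun g => (g, []), (litVars Q).map Term.var, varBound gs⟩], []⟩

/-- Invoked with `P` and `Q`, the engine terminates, and `A` is the list of all the answers it
returns; an answer is the tuple of the values of the variables of `Q`. -/
def TerminatesWith (P : List (HornClause CmpPred K R I)) (Q : List (Literal K R I))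
    (A : List (List (Term I))) : Prop :=
  ∃ n : ℕ, (engineStep P)^[n] (initialState Q) = ⟨[], A⟩

end Engine

/-! ## Answers -/

section Answers

variable {K : Type u} {R : Type v} {I : Type w}

/-- `σ` is a ground instantiation of the variables of `Q`. -/
def IsGroundFor (Q : List (Literal K R I)) (σ : Subst I) : Prop :=
  ∀ x ∈ litVars Q, ∃ a, σ x = .const a

/-- No negated concept `¬ p` equivalent to `⊤` occurs in `Q`. -/
def NoNegatedTop (S : Set (Clause K R I)) (Q : List (Literal K R I)) : Prop :=
  ∀ p t, (⟨false, .unary p t⟩ : Literal K R I) ∈ Q → ¬ Entails S [⟨false, .unary p (.var 0)⟩]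

end Answers

end DLog

open DLog

namespace DLog

/-! ## Substitutions and unifiers -/

section Substitution

variable {K : Type u} {R : Type v} {I : Type w}

/-! The DL restrictions split the program into three kinds of clauses (`ClauseShape`,
`IsDLogProgram.clauseShape`). By (p4), clauses with a binary head mention binary atoms only and have
the same variables in head and body, so a solved binary goal is ground. In a clause with a unary
head and a binary literal, (p3) and the binary-first rule ensure that binary goals ground all
variables before they matter. The remaining clauses are ground or consist of unary atoms on one
variable. Hence, whenever a unary goal is selected, it and its ancestors are either all ground or
are unary goals on one common term (`Admissible.unary`). This invariant makes deterministic ancestor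
resolution harmless: a unifiable ancestor is literally the complement of the goal, and nothing gets
instantiated (`Admissible.ancestorStep`).

Termination: loop elimination lets only finitely many distinct goals occur along a chain of
ancestors. The exponent `k` of a goal measures the goals over the finite signature that are not yet
among its ancestors, and unary goals get an offset exceeding the exponent of any binary goal. With
`B` above all body lengths, resolution replaces a weight `B ^ k` by fewer than `B` summands `B ^ (k
- 1)` (`AdmissibleList.resolve`). So the depth-first engine exhausts the search tree
(`Frame.Admissible.run`).

Soundness (`Yields.sound`): in a successful branch, each goal or one of its ancestors is a
consequence of `S`. Excluded middle justifies ancestor resolution, and query goals have no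
ancestors.

Completeness: the role clauses are definite Horn clauses, so the derivable role facts form a least
role structure on the constants. Evaluating binary and equality literals there turns ground
instances of `S` into propositional clauses, each of whose satisfying valuations gives a model of
`S` (`groundInterp_isModel`). A ground unary literal entailed by `S` therefore follows
propositionally. Compactness and completeness of model elimination with a loop check
(`modelElim_of_entails`) give a ground derivation (`ModelElim.proves`); role facts have loop-free
derivations by minimal height (`RoleDerivable.proves`). Ground derivations are lifted to branches of
the search tree by most general unifiers (`Frame.Admissible.exists_yields`).

Reduced form serves groundness of answers: a variable left in an answer can occur only in unary
conjuncts, and such a conjunct would then be entailed for every element (`isGroundFor_of_entails`).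
-/

theorem Term.subst_subst (θ η : Subst I) (t : Term I) :
    (t.subst θ).subst η = t.subst fun x => (θ x).subst η := by
  cases t <;> rfl

theorem Term.subst_var (t : Term I) : t.subst Term.var = t := by
  cases t <;> rfl

theorem Term.subst_congr {θ η : Subst I} {t : Term I} (h : ∀ x ∈ t.vars, θ x = η x) :
    t.subst θ = t.subst η := by
  cases t with
  | var x => exact h x (by simp [Term.vars])
  | const a => rfl

theorem Term.mem_vars_subst {θ : Subst I} {t : Term I} {y : ℕ} :
    y ∈ (t.subst θ).vars ↔ ∃ x ∈ t.vars, y ∈ (θ x).vars := by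
  cases t <;> simp [Term.subst, Term.vars]

theorem Term.eq_var_of_mem_vars {t : Term I} {x : ℕ} (h : x ∈ t.vars) : t = .var x := by
  cases t <;> simp_all [Term.vars]

theorem Term.exists_const_of_vars {t : Term I} (h : ∀ x, x ∉ t.vars) : ∃ a, t = .const a := by
  cases t with
  | var x => exact absurd (by simp [Term.vars]) (h x)
  | const a => exact ⟨a, rfl⟩

theorem Goal.subst_subst (θ η : Subst I) (g : Goal CmpPred K R I) :
    (g.subst θ).subst η = g.subst fun x => (θ x).subst η := by
  cases g <;> simp [Goal.subst, Term.subst_subst]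

theorem Goal.subst_var (g : Goal CmpPred K R I) : g.subst Term.var = g := by
  cases g <;> simp [Goal.subst, Term.subst_var]

theorem Goal.args_subst (θ : Subst I) (g : Goal CmpPred K R I) :
    (g.subst θ).args = g.args.map (Term.subst θ) := by
  cases g <;> rfl

theorem Goal.mem_vars {g : Goal CmpPred K R I} {x : ℕ} :
    x ∈ g.vars ↔ ∃ t ∈ g.args, x ∈ t.vars := by
  simp [Goal.vars]

theorem Goal.subst_congr {θ η : Subst I} {g : Goal CmpPred K R I}
    (h : ∀ x ∈ g.vars, θ x = η x) : g.subst θ = g.subst η := by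
  have key : ∀ t ∈ g.args, t.subst θ = t.subst η := fun t ht =>
    Term.subst_congr fun x hx => h x (Goal.mem_vars.2 ⟨t, ht, hx⟩)
  cases g <;> simp_all [Goal.subst, Goal.args]

theorem Goal.subst_eq_self {θ : Subst I} {g : Goal CmpPred K R I} (h : ∀ x, x ∉ g.vars) :
    g.subst θ = g :=
  (Goal.subst_congr fun x hx => absurd hx (h x)).trans g.subst_var

theorem Goal.mem_vars_subst {θ : Subst I} {g : Goal CmpPred K R I} {y : ℕ} :
    y ∈ (g.subst θ).vars ↔ ∃ x ∈ g.vars, y ∈ (θ x).vars := by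
  simp only [Goal.mem_vars, Goal.args_subst, List.mem_map]
  constructor
  · rintro ⟨_, ⟨t, ht, rfl⟩, hy⟩
    obtain ⟨x, hx, hy⟩ := Term.mem_vars_subst.1 hy
    exact ⟨x, ⟨t, ht, hx⟩, hy⟩
  · rintro ⟨x, ⟨t, ht, hx⟩, hy⟩
    exact ⟨_, ⟨t, ht, rfl⟩, Term.mem_vars_subst.2 ⟨x, hx, hy⟩⟩

theorem Goal.isBinary_subst {θ : Subst I} {g : Goal CmpPred K R I} :
    (g.subst θ).IsBinary ↔ g.IsBinary := by
  cases g <;> simp [Goal.subst, Goal.IsBinary]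

theorem Goal.isUnary_subst {θ : Subst I} {g : Goal CmpPred K R I} :
    (g.subst θ).IsUnary ↔ g.IsUnary := by
  cases g <;> simp [Goal.subst, Goal.IsUnary]

theorem Goal.neg_subst (θ : Subst I) (g : Goal CmpPred K R I) :
    (g.subst θ).neg = g.neg.subst θ := by
  rcases g with _ | _ | ⟨_ | _, _, _⟩ <;> rfl

variable [DecidableEq I]

theorem Term.mgu_unifies {s t : Term I} {θ : Subst I} (h : s.mgu t = some θ) :
    s.subst θ = t.subst θ := by
  rcases s with x | a <;> rcases t with y | b <;>
    simp only [Term.mgu, Option.some.injEq, Option.ite_none_right_eq_some] at h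
  · subst h
    by_cases hxy : y = x <;> simp [Term.subst, Subst.single, hxy]
  · subst h; simp [Term.subst, Subst.single]
  · subst h; simp [Term.subst, Subst.single]
  · obtain ⟨rfl, -⟩ := h; rfl

/-- The unifier only replaces a variable by a term with the same value under `δ`. Having `δ` itself
as the second factor means that lifting can keep one substitution across a resolution step. -/
theorem Term.exists_mgu {s t : Term I} {δ : Subst I} (h : s.subst δ = t.subst δ) :
    ∃ θ, s.mgu t = some θ ∧ ∀ x, (θ x).subst δ = δ x := by
  rcases s with x | a
  · refine ⟨_, rfl, fun y => ?_⟩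
    by_cases hy : y = x
    · subst hy; simpa [Subst.single, Term.subst] using h.symm
    · simp [Subst.single, hy, Term.subst]
  · rcases t with y | b
    · refine ⟨_, rfl, fun z => ?_⟩
      by_cases hz : z = y
      · subst hz; simpa [Subst.single, Term.subst] using h
      · simp [Subst.single, hz, Term.subst]
    · have hab : a = b := by simpa [Term.subst] using h
      exact ⟨Term.var, by simp [Term.mgu, hab], fun _ => rfl⟩

theorem Term.mgu_self (t : Term I) : t.mgu t = some Term.var := by
  cases t with
  | var x =>
    simp only [Term.mgu, Option.some.injEq]
    funext y
    by_cases hy : y = x <;> simp [Subst.single, hy]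
  | const a => simp [Term.mgu]

/-- A property of terms shared by the unified terms is preserved by their unifier. -/
theorem Term.mgu_preserves {s t : Term I} {θ : Subst I} (h : s.mgu t = some θ)
    {T : Term I → Prop} (hs : T s) (ht : T t) (u : Term I) (hu : T u) : T (u.subst θ) := by
  rcases u with z | c
  · rcases s with x | a <;> rcases t with y | b <;>
      simp only [Term.mgu, Option.some.injEq, Option.ite_none_right_eq_some] at h
    · subst h; simp only [Term.subst, Subst.single]; split_ifs <;> assumption
    · subst h; simp only [Term.subst, Subst.single]; split_ifs <;> assumption
    · subst h; simp only [Term.subst, Subst.single]; split_ifs <;> assumption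
    · obtain ⟨-, rfl⟩ := h; exact hu
  · exact hu

variable [DecidableEq K] [DecidableEq R]

theorem Goal.mgu_unifies {g h : Goal CmpPred K R I} {θ : Subst I} (hθ : g.mgu h = some θ) :
    g.subst θ = h.subst θ := by
  rcases g with ⟨p, s⟩ | ⟨r, s, s'⟩ | _ <;> rcases h with ⟨q, t⟩ | ⟨q, t, t'⟩ | _ <;>
    simp only [Goal.mgu, Option.ite_none_right_eq_some, reduceCtorEq] at hθ
  · obtain ⟨rfl, hθ⟩ := hθ
    simp [Goal.subst, Term.mgu_unifies hθ]
  · obtain ⟨rfl, hθ⟩ := hθ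
    simp only [Option.bind_eq_some_iff, Option.map_eq_some_iff] at hθ
    obtain ⟨θ₁, h₁, θ₂, h₂, rfl⟩ := hθ
    simp only [Goal.subst, ← Term.subst_subst, Term.mgu_unifies h₁, Term.mgu_unifies h₂]

theorem Goal.exists_mgu {g h : Goal CmpPred K R I} (hg : g.IsUnary ∨ g.IsBinary) {δ : Subst I}
    (hδ : g.subst δ = h.subst δ) : ∃ θ, g.mgu h = some θ ∧ ∀ x, (θ x).subst δ = δ x := by
  rcases g with ⟨p, s⟩ | ⟨r, s, s'⟩ | _ <;> rcases h with ⟨q, t⟩ | ⟨q, t, t'⟩ | _ <;>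
    simp only [Goal.subst, Goal.unary.injEq, Goal.binary.injEq, reduceCtorEq] at hδ
  · obtain ⟨rfl, hδ⟩ := hδ
    simpa [Goal.mgu] using Term.exists_mgu hδ
  · obtain ⟨rfl, hδ, hδ'⟩ := hδ
    obtain ⟨θ₁, h₁, hθ₁⟩ := Term.exists_mgu hδ
    have hsub : ∀ u : Term I, (u.subst θ₁).subst δ = u.subst δ := fun u => by
      rw [Term.subst_subst]; exact Term.subst_congr fun x _ => hθ₁ x
    obtain ⟨θ₂, h₂, hθ₂⟩ : ∃ θ, (s'.subst θ₁).mgu (t'.subst θ₁) = some θ ∧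
        ∀ x, (θ x).subst δ = δ x := Term.exists_mgu (by rw [hsub, hsub, hδ'])
    refine ⟨fun x => (θ₁ x).subst θ₂, by simp [Goal.mgu, h₁, h₂], fun x => ?_⟩
    rw [Term.subst_subst, ← hθ₁ x]
    exact (Term.subst_congr fun y _ => hθ₂ y)
  · simp [Goal.IsUnary, Goal.IsBinary] at hg

theorem Goal.mgu_preserves {g h : Goal CmpPred K R I} {θ : Subst I} (hθ : g.mgu h = some θ)
    {T : Term I → Prop} (hg : ∀ t ∈ g.args, T t) (hh : ∀ t ∈ h.args, T t) (u : Term I)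
    (hu : T u) : T (u.subst θ) := by
  rcases g with ⟨p, s⟩ | ⟨r, s, s'⟩ | _ <;> rcases h with ⟨q, t⟩ | ⟨q, t, t'⟩ | _ <;>
    simp only [Goal.mgu, Option.ite_none_right_eq_some, reduceCtorEq] at hθ
  · exact Term.mgu_preserves hθ.2 (hg _ (by simp [Goal.args])) (hh _ (by simp [Goal.args])) u hu
  · obtain ⟨-, hθ⟩ := hθ
    simp only [Option.bind_eq_some_iff, Option.map_eq_some_iff] at hθ
    obtain ⟨θ₁, h₁, θ₂, h₂, rfl⟩ := hθ
    have key := Term.mgu_preserves h₁ (T := T) (hg _ (by simp [Goal.args]))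
      (hh _ (by simp [Goal.args]))
    rw [← Term.subst_subst]
    exact Term.mgu_preserves h₂ (key _ (hg _ (by simp [Goal.args])))
      (key _ (hh _ (by simp [Goal.args]))) _ (key _ hu)

end Substitution

/-! ## Goals over a finite signature -/

/-- Finite sets of predicate names and constants. -/
structure Signature (K : Type u) (R : Type v) (I : Type w) where
  concepts : Finset (PName K)
  roles : Finset (PName R)
  consts : Finset I

section Signature

variable {K : Type u} {R : Type v} {I : Type w}

/-- The constants of the term belong to `Γ`, and its variables are smaller than `n`. -/
def Term.Over (Γ : Signature K R I) (n : ℕ) : Term I → Prop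
  | .var x => x < n
  | .const a => a ∈ Γ.consts

/-- The names in the goal belong to `Γ`, and its variables are smaller than `n`. -/
def Goal.Over (Γ : Signature K R I) (n : ℕ) : Goal CmpPred K R I → Prop
  | .unary p t => p ∈ Γ.concepts ∧ t.Over Γ n
  | .binary r s t => r ∈ Γ.roles ∧ s.Over Γ n ∧ t.Over Γ n
  | .test _ s t => s.Over Γ n ∧ t.Over Γ n

variable {Γ : Signature K R I}

theorem Term.Over.mono {m n : ℕ} (hmn : m ≤ n) {t : Term I} (h : t.Over Γ m) : t.Over Γ n := by
  cases t with
  | var x => exact lt_of_lt_of_le h hmn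
  | const a => exact h

theorem Goal.Over.mono {m n : ℕ} (hmn : m ≤ n) {g : Goal CmpPred K R I} (h : g.Over Γ m) :
    g.Over Γ n := by
  cases g with
  | unary p t => exact ⟨h.1, h.2.mono hmn⟩
  | binary r s t => exact ⟨h.1, h.2.1.mono hmn, h.2.2.mono hmn⟩
  | test e s t => exact ⟨h.1.mono hmn, h.2.mono hmn⟩

theorem Goal.Over.args {n : ℕ} {g : Goal CmpPred K R I} (h : g.Over Γ n) :
    ∀ t ∈ g.args, t.Over Γ n := by
  cases g <;> simp_all [Goal.Over, Goal.args]

theorem Goal.Over.subst {m n : ℕ} {g : Goal CmpPred K R I} (h : g.Over Γ m) {θ : Subst I}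
    (hθ : ∀ t : Term I, t.Over Γ m → (t.subst θ).Over Γ n) : (g.subst θ).Over Γ n := by
  cases g <;> simp_all [Goal.Over, Goal.subst]

theorem Term.Over.lt {n : ℕ} {t : Term I} (h : t.Over Γ n) {x : ℕ} (hx : x ∈ t.vars) :
    x < n := by
  rw [Term.eq_var_of_mem_vars hx] at h; exact h

theorem Goal.Over.lt {n : ℕ} {g : Goal CmpPred K R I} (h : g.Over Γ n) {x : ℕ}
    (hx : x ∈ g.vars) : x < n := by
  obtain ⟨t, ht, hx⟩ := Goal.mem_vars.1 hx
  exact (h.args t ht).lt hx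

theorem lt_varBound {gs : List (Goal CmpPred K R I)} {g : Goal CmpPred K R I} (hg : g ∈ gs)
    {x : ℕ} (hx : x ∈ g.vars) : x < varBound gs := by
  have key : ∀ l : List ℕ, ∀ m ∈ l, m ≤ l.foldr max 0 := by
    intro l
    induction l with
    | nil => simp
    | cons a l ih =>
      intro m hm
      rcases List.mem_cons.1 hm with rfl | hm
      · exact le_max_left _ _
      · exact (ih m hm).trans (le_max_right _ _)
  exact key _ _ (List.mem_map.2 ⟨x, List.mem_flatMap.2 ⟨g, hg, hx⟩, rfl⟩)

variable [DecidableEq I]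

/-- The terms over `Γ` with variables in `V`. -/
def Signature.terms (Γ : Signature K R I) (V : Finset ℕ) : Finset (Term I) :=
  V.image Term.var ∪ Γ.consts.image Term.const

theorem Signature.mem_terms {V : Finset ℕ} {t : Term I} :
    t ∈ Γ.terms V ↔ (∃ x ∈ V, t = .var x) ∨ ∃ a ∈ Γ.consts, t = .const a := by
  simp [Signature.terms, eq_comm]

theorem Term.Over.mem_terms {n : ℕ} {t : Term I} (h : t.Over Γ n) {V : Finset ℕ}
    (hV : ∀ x ∈ t.vars, x ∈ V) : t ∈ Γ.terms V := by
  rw [Signature.mem_terms]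
  cases t with
  | var x => exact Or.inl ⟨x, hV x (by simp [Term.vars]), rfl⟩
  | const a => exact Or.inr ⟨a, h, rfl⟩

variable [DecidableEq K] [DecidableEq R]

/-- Finitely many goals are over a common finite signature. -/
theorem exists_signature (gs : List (Goal CmpPred K R I)) :
    ∃ Γ : Signature K R I, ∀ g ∈ gs, ∀ n, (∀ x ∈ g.vars, x < n) → g.Over Γ n := by
  induction gs with
  | nil => exact ⟨⟨∅, ∅, ∅⟩, by simp⟩
  | cons g gs ih =>
    obtain ⟨Γ, hΓ⟩ := ih
    let consts : Term I → Finset I := fun t => match t with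
      | .var _ => ∅
      | .const a => {a}
    have hterm : ∀ (Δ : Signature K R I) (t : Term I) (n : ℕ), consts t ⊆ Δ.consts →
        (∀ x ∈ t.vars, x < n) → t.Over Δ n := by
      rintro Δ (x | a) n h hx
      · exact hx x (by simp [Term.vars])
      · exact h (Finset.mem_singleton_self a)
    have hmono : ∀ Δ : Signature K R I, Γ.concepts ⊆ Δ.concepts → Γ.roles ⊆ Δ.roles →
        Γ.consts ⊆ Δ.consts → ∀ (h : Goal CmpPred K R I) (n : ℕ), h.Over Γ n → h.Over Δ n := by
      intro Δ h₁ h₂ h₃ h n hh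
      have ht : ∀ t : Term I, t.Over Γ n → t.Over Δ n := by
        rintro (x | a) ht
        · exact ht
        · exact h₃ ht
      cases h with
      | unary p t => exact ⟨h₁ hh.1, ht _ hh.2⟩
      | binary r s t => exact ⟨h₂ hh.1, ht _ hh.2.1, ht _ hh.2.2⟩
      | test e s t => exact ⟨ht _ hh.1, ht _ hh.2⟩
    have hargs : ∀ {t : Term I} {n : ℕ}, t ∈ g.args → (∀ x ∈ g.vars, x < n) →
        ∀ x ∈ t.vars, x < n := fun ht hx x hxt => hx x (Goal.mem_vars.2 ⟨_, ht, hxt⟩)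
    refine ⟨⟨Γ.concepts ∪ (match g with | .unary p _ => {p} | _ => ∅),
      Γ.roles ∪ (match g with | .binary r _ _ => {r} | _ => ∅),
      Γ.consts ∪ (g.args.map consts).foldr (· ∪ ·) ∅⟩, fun h hh n hx => ?_⟩
    rcases List.mem_cons.1 hh with rfl | hh
    · cases h with
      | unary p t =>
        exact ⟨by simp, hterm _ _ _ (by intro; simp +contextual [Goal.args])
          (hargs (by simp [Goal.args]) hx)⟩
      | binary r s t =>
        exact ⟨by simp, hterm _ _ _ (by intro; simp +contextual [Goal.args])
          (hargs (by simp [Goal.args]) hx), hterm _ _ _ (by intro; simp +contextual [Goal.args])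
          (hargs (by simp [Goal.args]) hx)⟩
      | test e s t =>
        exact ⟨hterm _ _ _ (by intro; simp +contextual [Goal.args])
          (hargs (by simp [Goal.args]) hx), hterm _ _ _ (by intro; simp +contextual [Goal.args])
          (hargs (by simp [Goal.args]) hx)⟩
    · exact hmono _ Finset.subset_union_left Finset.subset_union_left Finset.subset_union_left
        _ _ (hΓ h hh n hx)

/-- The unary and binary goals over `Γ` with variables in `V`. -/
def Signature.goals (Γ : Signature K R I) (V : Finset ℕ) : Finset (Goal CmpPred K R I) :=
  (Γ.concepts ×ˢ Γ.terms V).image (fun q => .unary q.1 q.2) ∪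
    (Γ.roles ×ˢ Γ.terms V ×ˢ Γ.terms V).image (fun q => .binary q.1 q.2.1 q.2.2)

theorem Signature.unary_mem_goals {V : Finset ℕ} {p : PName K} {t : Term I} :
    .unary p t ∈ Γ.goals V ↔ p ∈ Γ.concepts ∧ t ∈ Γ.terms V := by
  simp [Signature.goals]

theorem Signature.binary_mem_goals {V : Finset ℕ} {r : PName R} {s t : Term I} :
    .binary r s t ∈ Γ.goals V ↔ r ∈ Γ.roles ∧ s ∈ Γ.terms V ∧ t ∈ Γ.terms V := by
  simp [Signature.goals]

theorem Signature.test_notMem_goals {V : Finset ℕ} {e : CmpPred} {s t : Term I} :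
    .test e s t ∉ Γ.goals V := by
  simp [Signature.goals]

theorem Goal.Over.mem_goals {n : ℕ} {g : Goal CmpPred K R I} (h : g.Over Γ n)
    (hg : g.IsUnary ∨ g.IsBinary) {V : Finset ℕ} (hV : ∀ x ∈ g.vars, x ∈ V) :
    g ∈ Γ.goals V := by
  cases g with
  | unary p t =>
    exact Signature.unary_mem_goals.2 ⟨h.1, h.2.mem_terms fun x hx =>
      hV x (Goal.mem_vars.2 ⟨t, by simp [Goal.args], hx⟩)⟩
  | binary r s t =>
    exact Signature.binary_mem_goals.2 ⟨h.1, h.2.1.mem_terms fun x hx =>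
      hV x (Goal.mem_vars.2 ⟨s, by simp [Goal.args], hx⟩), h.2.2.mem_terms fun x hx =>
      hV x (Goal.mem_vars.2 ⟨t, by simp [Goal.args], hx⟩)⟩
  | test e s t => simp [Goal.IsUnary, Goal.IsBinary] at hg

/-- The number of goals over `Γ` with variables in `V` that do not occur in `anc`. -/
def Signature.room (Γ : Signature K R I) (V : Finset ℕ) (anc : List (Goal CmpPred K R I)) : ℕ :=
  (Γ.goals V \ anc.toFinset).card

theorem Signature.exists_subst_of_mem_goals {V V' : Finset ℕ} {θ : Subst I}
    (hV : ∀ y ∈ V', ∃ x ∈ V, θ x = .var y) {g : Goal CmpPred K R I} (hg : g ∈ Γ.goals V') :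
    ∃ h ∈ Γ.goals V, h.subst θ = g := by
  have hterm : ∀ t ∈ Γ.terms V', ∃ s ∈ Γ.terms V, s.subst θ = t := by
    intro t ht
    rcases Signature.mem_terms.1 ht with ⟨y, hy, rfl⟩ | ⟨a, ha, rfl⟩
    · obtain ⟨x, hx, hxy⟩ := hV y hy
      exact ⟨.var x, Signature.mem_terms.2 (.inl ⟨x, hx, rfl⟩), hxy⟩
    · exact ⟨.const a, Signature.mem_terms.2 (.inr ⟨a, ha, rfl⟩), rfl⟩
  cases g with
  | unary p t =>
    obtain ⟨hp, ht⟩ := Signature.unary_mem_goals.1 hg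
    obtain ⟨s, hs, rfl⟩ := hterm t ht
    exact ⟨.unary p s, Signature.unary_mem_goals.2 ⟨hp, hs⟩, rfl⟩
  | binary r s t =>
    obtain ⟨hr, hs, ht⟩ := Signature.binary_mem_goals.1 hg
    obtain ⟨s', hs', rfl⟩ := hterm s hs
    obtain ⟨t', ht', rfl⟩ := hterm t ht
    exact ⟨.binary r s' t', Signature.binary_mem_goals.2 ⟨hr, hs', ht'⟩, rfl⟩
  | test e s t => exact absurd hg Signature.test_notMem_goals

/-- Every goal over `V'` is the `θ`-instance of a goal over `V`, and if the instance avoids the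
instantiated ancestors then its preimage avoids the original ones. Thus instantiation never creates
room. -/
theorem Signature.room_subst_le {V V' : Finset ℕ} {θ : Subst I}
    (hV : ∀ y ∈ V', ∃ x ∈ V, θ x = .var y) (anc : List (Goal CmpPred K R I)) :
    Γ.room V' (anc.map (Goal.subst θ)) ≤ Γ.room V anc := by
  refine (Finset.card_le_card ?_).trans (Finset.card_image_le (f := Goal.subst θ))
  intro g hg
  obtain ⟨hg, hanc⟩ := Finset.mem_sdiff.1 hg
  obtain ⟨h, hh, rfl⟩ := Signature.exists_subst_of_mem_goals hV hg
  refine Finset.mem_image_of_mem _ (Finset.mem_sdiff.2 ⟨hh, fun hmem => hanc ?_⟩)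
  exact List.mem_toFinset.2 (List.mem_map_of_mem (List.mem_toFinset.1 hmem))

/-- This is the contribution of loop elimination to termination: a goal that passes the check
occupies a new place among the ancestors. -/
theorem Signature.room_cons_subst_lt {V V' : Finset ℕ} {θ : Subst I}
    (hV : ∀ y ∈ V', ∃ x ∈ V, θ x = .var y) {g : Goal CmpPred K R I}
    {anc : List (Goal CmpPred K R I)} (hg : g ∈ Γ.goals V) (hanc : g ∉ anc) :
    Γ.room V' ((g :: anc).map (Goal.subst θ)) < Γ.room V anc := by
  refine (Signature.room_subst_le hV (g :: anc)).trans_lt (Finset.card_lt_card ?_)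
  refine ⟨Finset.sdiff_subset_sdiff le_rfl (by simp), fun hsub => ?_⟩
  have := hsub (Finset.mem_sdiff.2 ⟨hg, by simpa using hanc⟩)
  simp at this

/-- The number of goals over `Γ` with two variables. -/
def Signature.binaryRoom (Γ : Signature K R I) : ℕ := Γ.room {0, 1} []

theorem Signature.room_le_binaryRoom {V : Finset ℕ} {s t : Term I}
    (hV : ∀ y ∈ V, y ∈ s.vars ∨ y ∈ t.vars) (anc : List (Goal CmpPred K R I)) :
    Γ.room V anc ≤ Γ.binaryRoom := by
  have hle : Γ.room V anc ≤ Γ.room V [] :=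
    Finset.card_le_card (Finset.sdiff_subset_sdiff le_rfl (by simp))
  -- The variables `0` and `1` stand for the two argument places; sending them to `s` and `t`
  -- reaches every variable in `V`.
  refine hle.trans (Signature.room_subst_le (θ := fun x => if x = 0 then s else t) ?_ [])
  intro y hy
  rcases hV y hy with h | h
  · exact ⟨0, by simp, by simpa using Term.eq_var_of_mem_vars h⟩
  · exact ⟨1, by simp, by simpa using Term.eq_var_of_mem_vars h⟩

end Signature

/-! ## Shape of the program clauses and invariants of the search -/

section Search

variable {K : Type u} {R : Type v} {I : Type w}

/-- The variables of the binary goals in a list. -/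
def binaryVars (gs : List (Goal CmpPred K R I)) : Set ℕ :=
  {x | ∃ g ∈ gs, g.IsBinary ∧ x ∈ g.vars}

/-- The three kinds of clauses of a DLog program: clauses with a binary head; clauses with a unary
head, where all variables are bound by binary goals before they are needed; and clauses which
consist of unary atoms with the same variable. -/
inductive ClauseShape (c : HornClause CmpPred K R I) : Prop
  | role (head : c.head.IsBinary) (body : ∀ b ∈ c.body, b.IsBinary)
      (vars : ∀ x, x ∈ c.head.vars ↔ ∃ b ∈ c.body, x ∈ b.vars)
  | connected (head : c.head.IsUnary)
      (body : ∀ l₁ b l₂, c.body = l₁ ++ b :: l₂ → ¬ b.IsBinary → ∀ x ∈ b.vars, x ∈ binaryVars l₁)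
      (vars : ∀ l₁ b l₂, c.body = l₁ ++ b :: l₂ → b.IsUnary →
        ∀ x ∈ c.head.vars, x ∈ binaryVars l₁)
  | uniform (p : PName K) (x : ℕ) (head : c.head = .unary p (.var x))
      (body : ∀ b ∈ c.body, ∃ q, b = .unary q (.var x))

theorem ClauseShape.head_isUnary_or_isBinary {c : HornClause CmpPred K R I}
    (h : ClauseShape c) : c.head.IsUnary ∨ c.head.IsBinary := by
  cases h with
  | role h => exact .inr h
  | connected h => exact .inl h
  | uniform p x h => exact .inl ⟨p, _, h⟩

theorem HornClause.rename_head_subst (c : HornClause CmpPred K R I) (n : ℕ) (θ : Subst I) :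
    (c.rename n).head.subst θ = c.head.subst fun x => θ (x + n) := by
  simp only [HornClause.rename, Goal.subst_subst]; rfl

theorem HornClause.rename_body_subst (c : HornClause CmpPred K R I) (n : ℕ) (θ : Subst I) :
    (c.rename n).body.map (Goal.subst θ) = c.body.map (Goal.subst fun x => θ (x + n)) := by
  simp only [HornClause.rename, List.map_map]
  refine List.map_congr_left fun b _ => ?_
  simp only [Function.comp, Goal.subst_subst]; rfl

theorem binaryVars_map_subst {gs : List (Goal CmpPred K R I)} {θ : Subst I} {x y : ℕ}
    (hx : x ∈ binaryVars gs) (hy : y ∈ (θ x).vars) : y ∈ binaryVars (gs.map (Goal.subst θ)) := by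
  obtain ⟨g, hg, hb, hx⟩ := hx
  exact ⟨_, List.mem_map_of_mem hg, Goal.isBinary_subst.2 hb, Goal.mem_vars_subst.2 ⟨x, hx, hy⟩⟩

theorem Frame.subst_var (f : Frame K R I) : f.subst Term.var = f := by
  have h₁ : (Goal.subst Term.var : Goal CmpPred K R I → _) = id := funext Goal.subst_var
  have h₂ : (Term.subst Term.var : Term I → _) = id := funext Term.subst_var
  rcases f with ⟨gs, ans, n⟩
  simp [Frame.subst, h₁, h₂]

variable [DecidableEq K] [DecidableEq R] [DecidableEq I]

/-- A goal with its ancestors is ready for execution as soon as the variables in `c` are bound: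
unary goals either have all variables (also in their ancestors) in `c`, or share one term with
their ancestors, and the variables of comparisons belong to `c`. The number `k` bounds the length
of a chain of descendants. -/
def Admissible (Γ : Signature K R I) (c : Set ℕ) :
    Goal CmpPred K R I → List (Goal CmpPred K R I) → ℕ → Prop
  | .unary p t, anc, k =>
      ((∀ h ∈ .unary p t :: anc, ∀ x ∈ h.vars, x ∈ c) ∧ Γ.binaryRoom + 2 + Γ.room ∅ anc ≤ k) ∨
      ((∀ a ∈ anc, ∃ q, a = .unary q t) ∧
        Γ.binaryRoom + 2 + Γ.room t.vars.toFinset anc ≤ k)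
  | .binary r s t, anc, k =>
      Γ.room (Goal.binary r s t : Goal CmpPred K R I).vars.toFinset anc + 1 ≤ k
  | .test e s t, _, _ => ∀ x ∈ (Goal.test e s t : Goal CmpPred K R I).vars, x ∈ c

/-- Each goal in the list is admissible as soon as the variables in `c` and those of the binary
goals to its left are bound; `w` is the total weight of the goals. -/
inductive AdmissibleList (Γ : Signature K R I) (B : ℕ) :
    Set ℕ → List (Goal CmpPred K R I × List (Goal CmpPred K R I)) → ℕ → Prop
  | nil (c : Set ℕ) : AdmissibleList Γ B c [] 0
  | cons {c : Set ℕ} {g : Goal CmpPred K R I} {anc : List (Goal CmpPred K R I)} {k w : ℕ}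
      {L : List (Goal CmpPred K R I × List (Goal CmpPred K R I))}
      (head : Admissible Γ c g anc k) (tail : AdmissibleList Γ B (c ∪ binaryVars [g]) L w) :
      AdmissibleList Γ B c ((g, anc) :: L) (B ^ k + w)

variable {Γ : Signature K R I} {B : ℕ}

/-- Both modes of a unary goal survive instantiation: variables of bound terms stay bound, and a
term shared with the ancestors stays shared. The exponent can be kept because room does not grow. -/
theorem Admissible.subst {c c' : Set ℕ} {g : Goal CmpPred K R I}
    {anc : List (Goal CmpPred K R I)} {k : ℕ} (h : Admissible Γ c g anc k) {θ : Subst I}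
    (hc : ∀ x ∈ c, ∀ y ∈ (θ x).vars, y ∈ c') :
    Admissible Γ c' (g.subst θ) (anc.map (Goal.subst θ)) k := by
  cases g with
  | unary p t =>
    rcases h with ⟨h, hk⟩ | ⟨h, hk⟩
    · refine .inl ⟨?_, ?_⟩
      · intro h' hh' y hy
        obtain ⟨h', hmem, rfl⟩ := List.mem_map.1
          (show h' ∈ (Goal.unary p t :: anc).map (Goal.subst θ) from hh')
        obtain ⟨x, hx, hy⟩ := Goal.mem_vars_subst.1 hy
        exact hc x (h h' hmem x hx) y hy
      · have := Signature.room_subst_le (Γ := Γ) (V := ∅) (V' := ∅) (θ := θ) (by simp) anc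
        omega
    · refine .inr ⟨?_, ?_⟩
      · intro a ha
        obtain ⟨a, ha', rfl⟩ := List.mem_map.1 ha
        obtain ⟨q, rfl⟩ := h a ha'
        exact ⟨q, rfl⟩
      · have := Signature.room_subst_le (Γ := Γ) (V := t.vars.toFinset)
          (V' := (t.subst θ).vars.toFinset) (θ := θ) (by
            intro y hy
            obtain ⟨x, hx, hy⟩ := Term.mem_vars_subst.1 (List.mem_toFinset.1 hy)
            exact ⟨x, by simpa using hx, Term.eq_var_of_mem_vars hy⟩) anc
        omega
  | binary r s t =>
    have := Signature.room_subst_le (Γ := Γ)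
      (V := (Goal.binary r s t : Goal CmpPred K R I).vars.toFinset)
      (V' := ((Goal.binary r s t : Goal CmpPred K R I).subst θ).vars.toFinset) (θ := θ) (by
        intro y hy
        obtain ⟨x, hx, hy⟩ := Goal.mem_vars_subst.1 (List.mem_toFinset.1 hy)
        exact ⟨x, by simpa using hx, Term.eq_var_of_mem_vars hy⟩) anc
    exact (Nat.add_le_add_right this 1).trans h
  | test e s t =>
    intro y hy
    obtain ⟨x, hx, hy⟩ := (Goal.mem_vars_subst (θ := θ) (g := .test e s t)).1 hy
    exact hc x (h x hx) y hy

theorem AdmissibleList.subst {c : Set ℕ}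
    {L : List (Goal CmpPred K R I × List (Goal CmpPred K R I))} {w : ℕ}
    (h : AdmissibleList Γ B c L w) {θ : Subst I} {c' : Set ℕ}
    (hc : ∀ x ∈ c, ∀ y ∈ (θ x).vars, y ∈ c') :
    AdmissibleList Γ B c' (L.map fun ga => (ga.1.subst θ, ga.2.map (Goal.subst θ))) w := by
  induction h generalizing c' with
  | nil c => exact .nil _
  | cons head tail ih =>
    refine .cons (head.subst hc) (ih ?_)
    rintro x (hx | hx) y hy
    · exact .inl (hc x hx y hy)
    · exact .inr (binaryVars_map_subst hx hy)

theorem AdmissibleList.mono {c c' : Set ℕ}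
    {L : List (Goal CmpPred K R I × List (Goal CmpPred K R I))} {w : ℕ}
    (h : AdmissibleList Γ B c L w) (hc : c ⊆ c') : AdmissibleList Γ B c' L w := by
  have h₁ : (Goal.subst Term.var : Goal CmpPred K R I → _) = id := funext Goal.subst_var
  have := h.subst (θ := Term.var) (c' := c') fun x hx y hy => by
    simp only [Term.vars, List.mem_singleton] at hy
    exact hy ▸ hc hx
  simpa [h₁] using this

/-- Used for pushing a clause body: all its goals get the same exponent, and each may rely on the
binary goals to its left inside the body. -/
theorem AdmissibleList.append {c : Set ℕ} {gs anc : List (Goal CmpPred K R I)} {k w : ℕ}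
    {L : List (Goal CmpPred K R I × List (Goal CmpPred K R I))}
    (h : ∀ l₁ b l₂, gs = l₁ ++ b :: l₂ → Admissible Γ (c ∪ binaryVars l₁) b anc k)
    (hL : AdmissibleList Γ B (c ∪ binaryVars gs) L w) :
    AdmissibleList Γ B c (gs.map (fun b => (b, anc)) ++ L) (gs.length * B ^ k + w) := by
  induction gs generalizing c with
  | nil => simpa [binaryVars] using hL
  | cons g gs ih =>
    have hun : ∀ l : List (Goal CmpPred K R I), c ∪ binaryVars [g] ∪ binaryVars l =
        c ∪ binaryVars (g :: l) := by
      intro l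
      rw [Set.union_assoc]
      congr 1
      ext x
      simp [binaryVars]
    have := AdmissibleList.cons (B := B) (by simpa [binaryVars] using h [] g gs rfl)
      (ih (c := c ∪ binaryVars [g]) (fun l₁ b l₂ hl => by
        rw [hun]; exact h (g :: l₁) b l₂ (by simp [hl])) (by rwa [hun]))
    rw [List.length_cons, add_mul, one_mul, add_comm (_ * _), add_assoc]
    exact this

/-- When a unary goal is executed, it and its ancestors are either ground or share one term. -/
theorem Admissible.unary {p : PName K} {t : Term I} {anc : List (Goal CmpPred K R I)} {k : ℕ}
    (h : Admissible Γ ∅ (.unary p t) anc k) :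
    Γ.binaryRoom + 2 + Γ.room t.vars.toFinset anc ≤ k ∧
      ((∀ h ∈ .unary p t :: anc, ∀ x, x ∉ h.vars) ∨ ∀ a ∈ anc, ∃ q, a = .unary q t) := by
  rcases h with ⟨h, hk⟩ | ⟨h, hk⟩
  · have ht : t.vars = [] := List.eq_nil_iff_forall_not_mem.2 fun x hx =>
      h _ (List.mem_cons_self) x (Goal.mem_vars.2 ⟨t, by simp [Goal.args], hx⟩)
    exact ⟨by rw [ht]; exact hk, .inl h⟩
  · exact ⟨hk, .inr h⟩

/-- Resolution with a program clause decreases the weight of the goals. -/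
theorem AdmissibleList.resolve {c : HornClause CmpPred K R I} (hc : ClauseShape c)
    (hB : c.body.length < B) {g : Goal CmpPred K R I} {anc : List (Goal CmpPred K R I)}
    {L : List (Goal CmpPred K R I × List (Goal CmpPred K R I))} {w n : ℕ}
    (h : AdmissibleList Γ B ∅ ((g, anc) :: L) w) (hg : g.Over Γ n) (hanc : g ∉ anc)
    {θ ρ : Subst I} (hθ : g.subst θ = c.head.subst ρ) :
    ∃ w' < w, AdmissibleList Γ B ∅
      ((c.body.map (Goal.subst ρ)).map (fun b => (b, (g :: anc).map (Goal.subst θ))) ++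
        L.map fun ga => (ga.1.subst θ, ga.2.map (Goal.subst θ))) w' := by
  obtain ⟨k, w, rfl, hk, hL⟩ : ∃ k w', w = B ^ k + w' ∧ Admissible Γ ∅ g anc k ∧
      AdmissibleList Γ B (∅ ∪ binaryVars [g]) L w' := by
    cases h with
    | cons hk hL => exact ⟨_, _, rfl, hk, hL⟩
  have hvars : ∀ y, y ∈ (g.subst θ).vars ↔ ∃ z ∈ c.head.vars, y ∈ (ρ z).vars := fun y => by
    rw [hθ, Goal.mem_vars_subst]
  have hkind : g.IsUnary ∨ g.IsBinary := by
    rw [← Goal.isUnary_subst (θ := θ), ← Goal.isBinary_subst (θ := θ), hθ, Goal.isUnary_subst,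
      Goal.isBinary_subst]
    exact hc.head_isUnary_or_isBinary
  have hgoals : ∀ V : Finset ℕ, (∀ x ∈ g.vars, x ∈ V) → g ∈ Γ.goals V :=
    fun V hV => hg.mem_goals hkind hV
  -- It suffices that the body goals are admissible with exponent `k - 1`, and that whatever `g` was
  -- going to bind for the later goals is bound by the binary goals of the body instead.
  suffices hs : 1 ≤ k ∧
      (∀ l₁ b l₂, c.body = l₁ ++ b :: l₂ → Admissible Γ (∅ ∪ binaryVars (l₁.map (Goal.subst ρ)))
        (b.subst ρ) ((g :: anc).map (Goal.subst θ)) (k - 1)) ∧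
      (∀ x ∈ binaryVars [g], ∀ y ∈ (θ x).vars, y ∈ binaryVars (c.body.map (Goal.subst ρ))) by
    obtain ⟨hk1, hbody, hbin⟩ := hs
    refine ⟨c.body.length * B ^ (k - 1) + w, ?_, ?_⟩
    · have hpos : 0 < B ^ (k - 1) := Nat.pow_pos (by omega)
      have : B ^ k = B * B ^ (k - 1) := by
        -- The factor `B` exceeds the body length, so the new summands together weigh less than the
        -- one removed.
        rw [← pow_succ', Nat.sub_add_cancel hk1]
      rw [this]
      exact Nat.add_lt_add_right (Nat.mul_lt_mul_of_pos_right hB hpos) w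
    · have := AdmissibleList.append (Γ := Γ) (B := B) (c := ∅) (gs := c.body.map (Goal.subst ρ))
        (anc := (g :: anc).map (Goal.subst θ)) (k := k - 1) (w := w)
        (L := L.map fun ga => (ga.1.subst θ, ga.2.map (Goal.subst θ))) (by
          intro l₁ b l₂ hl
          obtain ⟨m₁, m', hm, rfl, hm'⟩ := List.map_eq_append_iff.1 hl
          obtain ⟨b, m₂, rfl, rfl, rfl⟩ := List.map_eq_cons_iff.1 hm'
          exact hbody m₁ b m₂ hm) (hL.subst (by
          rintro x (hx | hx) y hy
          · exact absurd hx (Set.notMem_empty x)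
          · exact .inr (hbin x hx y hy)))
      simpa using this
  rcases g with ⟨p, t⟩ | ⟨r, s, t⟩ | _
  · obtain ⟨hk, hcases⟩ := hk.unary
    have hgmem := hgoals t.vars.toFinset (by simp [Goal.vars, Goal.args])
    refine ⟨by omega, ?_, by rintro x ⟨g, hg, hb, -⟩; simp_all [Goal.IsBinary]⟩
    -- Either there are no variables, or the common term is unified with the argument of the clause
    -- head. So binding the head variables also grounds all ancestors.
    have hanc_vars : ∀ a ∈ Goal.unary p t :: anc, ∀ y ∈ (a.subst θ).vars,
        ∃ z ∈ c.head.vars, y ∈ (ρ z).vars := by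
      intro a ha y hy
      rcases hcases with hgr | hun
      · obtain ⟨x, hx, -⟩ := Goal.mem_vars_subst.1 hy
        exact absurd hx (hgr a ha x)
      · rw [← hvars]
        rcases List.mem_cons.1 ha with rfl | ha
        · exact hy
        · obtain ⟨q, rfl⟩ := hun a ha
          exact hy
    cases hc with
    | role hhead =>
      rw [← Goal.isBinary_subst (θ := ρ), ← hθ] at hhead
      simp [Goal.subst, Goal.IsBinary] at hhead
    | connected _ hbody hhv =>
      intro l₁ b l₂ hl
      rcases b with ⟨q, s⟩ | ⟨r, s, s'⟩ | ⟨e, s, s'⟩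
      -- A unary body goal enters the ground mode: the preceding binary goals bind its own variables
      -- and those of the head.
      · have hlt := Signature.room_cons_subst_lt (V' := ∅) (θ := θ) (by simp) hgmem hanc
        refine .inl ⟨?_, by omega⟩
        intro h hh y hy
        right
        rcases List.mem_cons.1 hh with rfl | hh
        · obtain ⟨x, hx, hy⟩ :=
            (Goal.mem_vars_subst (θ := ρ) (g := .unary q s)).1 hy
          exact binaryVars_map_subst
            (hbody l₁ _ l₂ hl (by simp [Goal.IsBinary]) x hx) hy
        · obtain ⟨a, ha, rfl⟩ := List.mem_map.1 hh
          obtain ⟨z, hz, hy⟩ := hanc_vars a ha y hy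
          exact binaryVars_map_subst (hhv l₁ _ l₂ hl ⟨q, s, rfl⟩ z hz) hy
      -- The offset `binaryRoom + 2` pays for this call: one unit for the descent to `k - 1`, one
      -- for the `+ 1` in the exponent of a binary goal.
      · have := Signature.room_le_binaryRoom (Γ := Γ)
          (V := (Goal.binary r (s.subst ρ) (s'.subst ρ) : Goal CmpPred K R I).vars.toFinset)
          (s := s.subst ρ) (t := s'.subst ρ) (by simp [Goal.vars, Goal.args])
          ((Goal.unary p t :: anc).map (Goal.subst θ))
        change _ + 1 ≤ k - 1
        omega
      · intro y hy
        obtain ⟨x, hx, hy⟩ :=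
          (Goal.mem_vars_subst (θ := ρ) (g := .test e s s')).1 hy
        exact .inr (binaryVars_map_subst
          (hbody l₁ _ l₂ hl (by simp [Goal.IsBinary]) x hx) hy)
    | uniform p' x hhead hbody =>
      intro l₁ b l₂ hl
      obtain ⟨q, rfl⟩ := hbody b (by simp [hl])
      have hsub : t.subst θ = ρ x := by
        rw [hhead] at hθ
        simpa [Goal.subst, Term.subst] using (Goal.unary.inj hθ).2
      have hlt := Signature.room_cons_subst_lt (V' := (ρ x).vars.toFinset) (θ := θ) (by
        intro y hy
        rw [← hsub] at hy
        obtain ⟨x, hx, hy⟩ := Term.mem_vars_subst.1 (List.mem_toFinset.1 hy)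
        exact ⟨x, by simpa using hx, Term.eq_var_of_mem_vars hy⟩) hgmem hanc
      -- A clause on a single variable preserves the current mode, ground or with a shared term.
      rcases hcases with hgr | hun
      · have ht : ∀ y, y ∉ (ρ x).vars := by
          intro y hy
          rw [← hsub] at hy
          obtain ⟨z, hz, -⟩ := Term.mem_vars_subst.1 hy
          exact hgr _ List.mem_cons_self z (by simpa [Goal.vars, Goal.args] using hz)
        have hlt := Signature.room_cons_subst_lt (V' := ∅) (θ := θ) (by simp) hgmem hanc
        refine .inl ⟨?_, by omega⟩
        intro h hh y hy
        rcases List.mem_cons.1 hh with rfl | hh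
        · exact absurd (by simpa [Goal.vars, Goal.args, Term.subst] using hy) (ht y)
        · obtain ⟨a, ha, rfl⟩ := List.mem_map.1 hh
          obtain ⟨z, hz, -⟩ := Goal.mem_vars_subst.1 hy
          exact absurd hz (hgr a ha z)
      · refine .inr ⟨?_, by change _ + Γ.room (ρ x).vars.toFinset _ ≤ _; omega⟩
        intro a ha
        obtain ⟨a, ha', rfl⟩ := List.mem_map.1 ha
        rcases List.mem_cons.1 ha' with rfl | ha'
        · exact ⟨p, congrArg (Goal.unary p) hsub⟩
        · obtain ⟨q', rfl⟩ := hun a ha'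
          exact ⟨q', congrArg (Goal.unary q') hsub⟩
  · have hgmem := hgoals (Goal.binary r s t : Goal CmpPred K R I).vars.toFinset (by simp)
    have hhead : c.head.IsBinary := by
      rw [← Goal.isBinary_subst (θ := ρ), ← hθ]
      exact ⟨_, _, _, rfl⟩
    cases hc with
    | role _ hbody hbv =>
      have hk' : Γ.room (Goal.binary r s t : Goal CmpPred K R I).vars.toFinset anc + 1 ≤ k := hk
      refine ⟨by omega, ?_, ?_⟩
      -- Body variables occur in the head, so the new goals have no variables beyond those of the
      -- instantiated goal, and room shrinks by the loop check.
      · intro l₁ b l₂ hl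
        have hb : b ∈ c.body := by simp [hl]
        obtain ⟨r', s', t', rfl⟩ := hbody b hb
        have := Signature.room_cons_subst_lt (θ := θ)
          (V' := ((Goal.binary r' s' t' : Goal CmpPred K R I).subst ρ).vars.toFinset) (by
          intro y hy
          obtain ⟨z, hz, hy⟩ := Goal.mem_vars_subst.1 (List.mem_toFinset.1 hy)
          have : y ∈ ((Goal.binary r s t : Goal CmpPred K R I).subst θ).vars :=
            (hvars y).2 ⟨z, (hbv z).2 ⟨_, hb, hz⟩, hy⟩
          obtain ⟨x, hx, hy⟩ := Goal.mem_vars_subst.1 this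
          exact ⟨x, by simpa using hx, Term.eq_var_of_mem_vars hy⟩) hgmem hanc
        change Γ.room ((Goal.binary r' s' t' : Goal CmpPred K R I).subst ρ).vars.toFinset _ + 1 ≤ _
        omega
      · rintro x ⟨g, hg, -, hx⟩ y hy
        rw [List.mem_singleton.1 hg] at hx
        obtain ⟨z, hz, hy⟩ := (hvars y).1 (Goal.mem_vars_subst.2 ⟨x, hx, hy⟩)
        obtain ⟨b, hb, hz⟩ := (hbv z).1 hz
        exact binaryVars_map_subst ⟨b, hb, hbody b hb, hz⟩ hy
    | connected hu => obtain ⟨_, _, h₁⟩ := hu; obtain ⟨_, _, _, h₂⟩ := hhead; simp [h₁] at h₂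
    | uniform p x hu => obtain ⟨_, _, _, h₂⟩ := hhead; simp [hu] at h₂
  · simp [Goal.IsUnary, Goal.IsBinary] at hkind

end Search

/-! ## The search tree and termination -/

section Tree

variable {K : Type u} {R : Type v} {I : Type w} [DecidableEq K] [DecidableEq R] [DecidableEq I]

/-- The successful branches below the frame `f` return the answer `ts`. -/
inductive Yields (P : List (HornClause CmpPred K R I)) : Frame K R I → List (Term I) → Prop
  | done (ans : List (Term I)) (n : ℕ) : Yields P ⟨[], ans, n⟩ ans
  | step {g : Goal CmpPred K R I} {anc : List (Goal CmpPred K R I)}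
      {gs : List (Goal CmpPred K R I × List (Goal CmpPred K R I))} {ans : List (Term I)} {n : ℕ}
      {f : Frame K R I} {ts : List (Term I)} (hf : f ∈ alternatives P g anc ⟨gs, ans, n⟩)
      (hts : Yields P f ts) : Yields P ⟨(g, anc) :: gs, ans, n⟩ ts

theorem mem_alternatives {P : List (HornClause CmpPred K R I)} {g : Goal CmpPred K R I}
    (hg : g.IsUnary ∨ g.IsBinary) {anc : List (Goal CmpPred K R I)} {f f' : Frame K R I} :
    f' ∈ alternatives P g anc f ↔
      g ∉ anc ∧ (f' ∈ ancestorStep g anc f ∨ ∃ c ∈ P, clauseStep g anc f c = some f') := by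
  cases g with
  | test e s t => simp [Goal.IsUnary, Goal.IsBinary] at hg
  | unary p t => by_cases h : Goal.unary p t ∈ anc <;> simp [alternatives, h]
  | binary r s t => by_cases h : Goal.binary r s t ∈ anc <;> simp [alternatives, h]

theorem clauseStep_eq_some {g : Goal CmpPred K R I} {anc : List (Goal CmpPred K R I)}
    {gs : List (Goal CmpPred K R I × List (Goal CmpPred K R I))} {ans : List (Term I)} {n : ℕ}
    {c : HornClause CmpPred K R I} {f : Frame K R I} :
    clauseStep g anc ⟨gs, ans, n⟩ c = some f ↔ ∃ θ, g.mgu (c.rename n).head = some θ ∧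
      f = ⟨(c.body.map (Goal.subst fun x => θ (x + n))).map
          (fun b => (b, (g :: anc).map (Goal.subst θ))) ++
          gs.map fun ga => (ga.1.subst θ, ga.2.map (Goal.subst θ)),
        ans.map (Term.subst θ), n + varBound (c.head :: c.body)⟩ := by
  simp only [clauseStep, Option.map_eq_some_iff]
  refine exists_congr fun θ => and_congr_right fun _ => ?_
  rw [← HornClause.rename_body_subst, eq_comm]
  simp [Frame.subst, Function.comp_def]

theorem mem_ancestorStep {g : Goal CmpPred K R I} {anc : List (Goal CmpPred K R I)}
    {f f' : Frame K R I} (h : f' ∈ ancestorStep g anc f) :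
    g.IsUnary ∧ ∃ a ∈ anc, ∃ θ, g.neg.mgu a = some θ ∧ f' = f.subst θ := by
  cases g with
  | unary p t =>
    simp only [ancestorStep, Option.mem_toList, Option.map_eq_some_iff] at h
    obtain ⟨θ, hθ, rfl⟩ := h
    obtain ⟨a, ha, hθ⟩ := List.exists_of_findSome?_eq_some hθ
    exact ⟨⟨p, t, rfl⟩, a, ha, θ, hθ, rfl⟩
  | binary r s t => simp [ancestorStep] at h
  | test e s t => simp [ancestorStep] at h

theorem Goal.mgu_self {g : Goal CmpPred K R I} (hg : g.IsUnary) : g.mgu g = some Term.var := by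
  obtain ⟨p, t, rfl⟩ := hg
  simp [Goal.mgu, Term.mgu_self]

/-- Ancestor resolution in an admissible frame does not instantiate any variable. -/
theorem Admissible.ancestorStep {Γ : Signature K R I} {p : PName K} {t : Term I}
    {anc : List (Goal CmpPred K R I)} {k : ℕ} (h : Admissible Γ ∅ (.unary p t) anc k)
    (f : Frame K R I) :
    ancestorStep (.unary p t) anc f = if Goal.unary p.neg t ∈ anc then [f] else [] := by
  have key : ∀ a ∈ anc, (Goal.unary p.neg t).mgu a =
      if Goal.unary p.neg t = a then some Term.var else none := by
    intro a ha
    -- Ground goals unify only when equal. With a shared term, unifiability depends on the predicate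
    -- names alone.
    split_ifs with heq
    · rw [← heq]; exact Goal.mgu_self ⟨_, _, rfl⟩
    · rcases h.unary.2 with hgr | hun
      · rcases a with ⟨q, s⟩ | _ | _
        · obtain ⟨b, rfl⟩ := Term.exists_const_of_vars (t := t) fun x hx =>
            hgr _ List.mem_cons_self x (Goal.mem_vars.2 ⟨_, by simp [Goal.args], hx⟩)
          obtain ⟨d, rfl⟩ := Term.exists_const_of_vars (t := s) fun x hx =>
            hgr _ (List.mem_cons_of_mem _ ha) x (Goal.mem_vars.2 ⟨_, by simp [Goal.args], hx⟩)
          simp_all [Goal.mgu, Term.mgu]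
        · rfl
        · rfl
      · obtain ⟨q, rfl⟩ := hun a ha
        simp_all [Goal.mgu]
  have hfind : anc.findSome? (fun a => (Goal.unary p.neg t).mgu a) =
      if Goal.unary p.neg t ∈ anc then some Term.var else none := by
    clear h
    induction anc with
    | nil => rfl
    | cons a anc ih =>
      have := ih fun a ha => key a (List.mem_cons_of_mem _ ha)
      rw [List.findSome?_cons, key a List.mem_cons_self, this]
      by_cases heq : Goal.unary p.neg t = a <;> simp [heq]
  rw [DLog.ancestorStep, Goal.neg, hfind]
  split_ifs <;> simp [Frame.subst_var]

/-- The clauses of `P` have the shape of DLog clauses, bounded bodies, and names from `Γ`. -/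
def AdmissibleProgram (Γ : Signature K R I) (B : ℕ) (P : List (HornClause CmpPred K R I)) :
    Prop :=
  0 < B ∧ ∀ c ∈ P, ClauseShape c ∧ c.body.length < B ∧
    ∀ g ∈ c.head :: c.body, g.Over Γ (varBound (c.head :: c.body))

/-- The goals of the frame are admissible with total weight `w`, its names belong to `Γ`, and its
variables are bounded by `f.fresh`. -/
structure Frame.Admissible (Γ : Signature K R I) (B : ℕ) (f : Frame K R I) (w : ℕ) : Prop where
  goals : AdmissibleList Γ B ∅ f.goals w
  goals_over : ∀ ga ∈ f.goals, ga.1.Over Γ f.fresh ∧ ∀ a ∈ ga.2, a.Over Γ f.fresh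
  answer : ∀ t ∈ f.answer, t.Over Γ f.fresh

variable {Γ : Signature K R I} {B : ℕ} {P : List (HornClause CmpPred K R I)}

theorem AdmissibleList.tail {g : Goal CmpPred K R I} (hg : ¬ g.IsBinary)
    {anc : List (Goal CmpPred K R I)}
    {gs : List (Goal CmpPred K R I × List (Goal CmpPred K R I))} {w : ℕ} (hB : 0 < B)
    (h : AdmissibleList Γ B ∅ ((g, anc) :: gs) w) :
    ∃ w' < w, AdmissibleList Γ B ∅ gs w' := by
  cases h with
  | @cons _ _ _ k w _ hk hL =>
    refine ⟨w, Nat.lt_add_of_pos_left (Nat.pow_pos hB), hL.mono ?_⟩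
    rintro x (hx | ⟨g', hg', hb, -⟩)
    · exact hx
    · exact absurd (List.mem_singleton.1 hg' ▸ hb) hg

theorem AdmissibleList.head {g : Goal CmpPred K R I} {anc : List (Goal CmpPred K R I)}
    {gs : List (Goal CmpPred K R I × List (Goal CmpPred K R I))} {w : ℕ}
    (h : AdmissibleList Γ B ∅ ((g, anc) :: gs) w) : ∃ k, DLog.Admissible Γ ∅ g anc k := by
  cases h with
  | cons hk hL => exact ⟨_, hk⟩

/-- Ancestor resolution and comparisons only remove a goal, and clause resolution is covered by
`AdmissibleList.resolve`. The rest checks that unifiers introduce neither new names nor variables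
beyond the fresh bound. -/
theorem Frame.Admissible.step (hP : AdmissibleProgram Γ B P) {g : Goal CmpPred K R I}
    {anc : List (Goal CmpPred K R I)}
    {gs : List (Goal CmpPred K R I × List (Goal CmpPred K R I))} {ans : List (Term I)} {n w : ℕ}
    (h : (⟨(g, anc) :: gs, ans, n⟩ : Frame K R I).Admissible Γ B w) {f : Frame K R I}
    (hf : f ∈ alternatives P g anc ⟨gs, ans, n⟩) : ∃ w' < w, f.Admissible Γ B w' := by
  have hrest : ¬ g.IsBinary → ∃ w' < w, (⟨gs, ans, n⟩ : Frame K R I).Admissible Γ B w' := by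
    intro hg
    obtain ⟨w', hw, hL⟩ := AdmissibleList.tail hg hP.1 h.goals
    exact ⟨w', hw, hL, fun ga hga => h.goals_over ga (List.mem_cons_of_mem _ hga), h.answer⟩
  by_cases hg : g.IsUnary ∨ g.IsBinary
  · obtain ⟨hanc, hf | ⟨c, hc, hf⟩⟩ := (mem_alternatives hg).1 hf
    · obtain ⟨⟨p, t, rfl⟩, -⟩ := mem_ancestorStep hf
      obtain ⟨k, hk⟩ := AdmissibleList.head h.goals
      rw [hk.ancestorStep] at hf
      split_ifs at hf
      · rw [List.mem_singleton.1 hf]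
        exact hrest (by simp [Goal.IsBinary])
      · simp at hf
    · obtain ⟨θ, hθ, rfl⟩ := clauseStep_eq_some.1 hf
      obtain ⟨hshape, hlen, hover⟩ := hP.2 c hc
      have hg_over : g.Over Γ n := (h.goals_over (g, anc) List.mem_cons_self).1
      obtain ⟨w', hw, hL⟩ := AdmissibleList.resolve hshape hlen h.goals hg_over hanc
        (ρ := fun x => θ (x + n)) (by rw [Goal.mgu_unifies hθ, HornClause.rename_head_subst])
      set m := n + varBound (c.head :: c.body) with hm
      have hshift : ∀ t : Term I, t.Over Γ (varBound (c.head :: c.body)) →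
          (t.subst fun x => .var (x + n)).Over Γ m := by
        rintro (x | a) ht
        · have : x < varBound (c.head :: c.body) := ht
          change x + n < m
          omega
        · exact ht
      -- Unifiers are built from the terms being unified, so a bound valid for the goal and the
      -- renamed head is valid for their instances.
      have hkeep : ∀ t : Term I, t.Over Γ m → (t.subst θ).Over Γ m :=
        Goal.mgu_preserves hθ (fun t ht => (hg_over.args t ht).mono (by omega))
          (((hover c.head List.mem_cons_self).subst hshift).args)
      have hgoal : ∀ g' : Goal CmpPred K R I, g'.Over Γ n → (g'.subst θ).Over Γ m :=
        fun g' hg' => (hg'.mono (by omega : n ≤ m)).subst hkeep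
      refine ⟨w', hw, hL, ?_, ?_⟩
      · intro ga hga
        rcases List.mem_append.1 hga with hga | hga
        · obtain ⟨_, hb, rfl⟩ := List.mem_map.1 hga
          obtain ⟨b, hb', rfl⟩ := List.mem_map.1 hb
          refine ⟨(hover b (List.mem_cons_of_mem _ hb')).subst fun t ht => ?_, fun a ha => ?_⟩
          · have := hkeep _ (hshift t ht)
            rwa [Term.subst_subst] at this
          · obtain ⟨a, ha', rfl⟩ := List.mem_map.1 ha
            rcases List.mem_cons.1 ha' with rfl | ha'
            · exact hgoal _ hg_over
            · exact hgoal _ ((h.goals_over (g, anc) List.mem_cons_self).2 a ha')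
        · obtain ⟨ga, hga', rfl⟩ := List.mem_map.1 hga
          have := h.goals_over ga (List.mem_cons_of_mem _ hga')
          refine ⟨hgoal _ this.1, fun a ha => ?_⟩
          obtain ⟨a, ha', rfl⟩ := List.mem_map.1 ha
          exact hgoal _ (this.2 a ha')
      · intro t ht
        obtain ⟨t, ht', rfl⟩ := List.mem_map.1 ht
        exact hkeep _ ((h.answer t ht').mono (by omega : n ≤ m))
  · cases g with
    | test e s t =>
      simp only [alternatives] at hf
      split_ifs at hf
      · rw [List.mem_singleton.1 hf]
        exact hrest fun hb => hg (.inr hb)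
      · simp at hf
    | unary p t => exact absurd (.inl ⟨p, t, rfl⟩) hg
    | binary r s t => exact absurd (.inr ⟨r, s, t, rfl⟩) hg

/-- The engine explores the whole search tree below an admissible frame. -/
theorem Frame.Admissible.run (hP : AdmissibleProgram Γ B P) {w : ℕ} {f : Frame K R I}
    (h : f.Admissible Γ B w) : ∃ (n : ℕ) (A' : List (List (Term I))),
      (∀ A fs, (engineStep P)^[n] ⟨f :: fs, A⟩ = ⟨fs, A ++ A'⟩) ∧
        ∀ ts, ts ∈ A' ↔ Yields P f ts := by
  induction w using Nat.strong_induction_on generalizing f with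
  | _ w ih =>
  -- The step count and answers are independent of the stack below and of earlier answers, so the
  -- runs of the alternatives can be concatenated.
  have hlist : ∀ l : List (Frame K R I), (∀ f ∈ l, ∃ w' < w, f.Admissible Γ B w') →
      ∃ (n : ℕ) (A' : List (List (Term I))),
        (∀ A fs, (engineStep P)^[n] ⟨l ++ fs, A⟩ = ⟨fs, A ++ A'⟩) ∧
          ∀ ts, ts ∈ A' ↔ ∃ f ∈ l, Yields P f ts := by
    intro l
    induction l with
    | nil => exact fun _ => ⟨0, [], by simp, by simp⟩
    | cons f l ihl =>
      intro hl
      obtain ⟨w', hw', hf⟩ := hl f List.mem_cons_self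
      obtain ⟨n₁, A₁, h₁, h₁'⟩ := ih w' hw' hf
      obtain ⟨n₂, A₂, h₂, h₂'⟩ := ihl fun f hf => hl f (List.mem_cons_of_mem _ hf)
      refine ⟨n₂ + n₁, A₁ ++ A₂, fun A fs => ?_, fun ts => ?_⟩
      · rw [Function.iterate_add_apply, List.cons_append, h₁, h₂, List.append_assoc]
      · simp [h₁', h₂']
  rcases f with ⟨_ | ⟨⟨g, anc⟩, gs⟩, ans, n⟩
  · refine ⟨1, [ans], fun A fs => rfl, fun ts => ?_⟩
    rw [List.mem_singleton]
    constructor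
    · rintro rfl; exact .done _ _
    · rintro ⟨⟩; rfl
  · obtain ⟨m, A', hrun, hA'⟩ := hlist (alternatives P g anc ⟨gs, ans, n⟩) fun f hf =>
      h.step hP hf
    refine ⟨m + 1, A', fun A fs => ?_, fun ts => ?_⟩
    · rw [Function.iterate_succ_apply]
      exact hrun A fs
    · rw [hA']
      constructor
      · rintro ⟨f, hf, hts⟩; exact .step hf hts
      · rintro (_ | ⟨hf, hts⟩); exact ⟨_, hf, hts⟩

end Tree

/-! ## Literals as goals, and the clauses of a DLog program -/

section Program

variable {K : Type u} {R : Type v} {I : Type w}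

/-- The goal of the engine that represents the literal `L`. -/
def Literal.goal (L : Literal K R I) : Goal CmpPred K R I := L.can.toCmp

theorem Literal.goal_neg (L : Literal K R I) : L.neg.goal = L.goal.neg := by
  rcases L with ⟨_ | _, _ | _ | _⟩ <;> rfl

theorem Literal.goal_subst (θ : Subst I) (L : Literal K R I) :
    (L.subst θ).goal = L.goal.subst θ := by
  rcases L with ⟨_ | _, _ | _ | _⟩ <;> rfl

theorem Literal.vars_goal (L : Literal K R I) : L.goal.vars = L.vars := by
  rcases L with ⟨_ | _, _ | _ | _⟩ <;> rfl

theorem Goal.vars_neg (g : Goal CmpPred K R I) : g.neg.vars = g.vars := by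
  rcases g with _ | _ | ⟨_ | _, _, _⟩ <;> rfl

theorem Goal.isBinary_neg {g : Goal CmpPred K R I} : g.neg.IsBinary ↔ g.IsBinary := by
  rcases g with _ | _ | ⟨_ | _, _, _⟩ <;> simp [Goal.neg, Goal.IsBinary]

theorem Goal.isUnary_neg {g : Goal CmpPred K R I} : g.neg.IsUnary ↔ g.IsUnary := by
  rcases g with _ | _ | ⟨_ | _, _, _⟩ <;> simp [Goal.neg, Goal.IsUnary]

theorem Literal.isBinary_goal {L : Literal K R I} : L.goal.IsBinary ↔ L.IsBinary := by
  rcases L with ⟨_ | _, _ | _ | _⟩ <;>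
    simp [Literal.goal, Literal.can, Goal.toCmp, Goal.IsBinary, Literal.IsBinary]

theorem Literal.isUnary_goal {L : Literal K R I} : L.goal.IsUnary ↔ L.IsUnary := by
  rcases L with ⟨_ | _, _ | _ | _⟩ <;>
    simp [Literal.goal, Literal.can, Goal.toCmp, Goal.IsUnary, Literal.IsUnary]

theorem Literal.isNegBinary_can {L : Literal K R I} :
    L.can.IsNegBinary ↔ L.IsBinary ∧ L.pos = false := by
  rcases L with ⟨_ | _, _ | _ | _⟩ <;>
    simp [Literal.can, Goal.IsNegBinary, Literal.IsBinary]

theorem Literal.isUnary_or_isBinary {L : Literal K R I} (h : ¬ L.IsEq) :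
    L.IsUnary ∨ L.IsBinary := by
  rcases L with ⟨b, _ | _ | _⟩ <;> simp_all [Literal.IsUnary, Literal.IsBinary, Literal.IsEq]

theorem mem_litVars {C : List (Literal K R I)} {x : ℕ} :
    x ∈ litVars C ↔ ∃ L ∈ C, x ∈ L.vars := by
  simp [litVars]

/-- Truth of a goal in an interpretation. -/
def Interp.GoalHolds (M : Interp K R I) (val : ℕ → M.Dom) : Goal CmpPred K R I → Prop
  | .unary (.plain p) t => M.concept p (M.term val t)
  | .unary (.not_ p) t => ¬ M.concept p (M.term val t)
  | .binary (.plain r) s t => M.role r (M.term val s) (M.term val t)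
  | .binary (.not_ r) s t => ¬ M.role r (M.term val s) (M.term val t)
  | .test .ident s t => M.term val s = M.term val t
  | .test .nident s t => M.term val s ≠ M.term val t

theorem Interp.goalHolds_goal {M : Interp K R I} {val : ℕ → M.Dom} {L : Literal K R I} :
    M.GoalHolds val L.goal ↔ M.LitHolds val L := by
  rcases L with ⟨_ | _, _ | _ | _⟩ <;>
    simp [Literal.goal, Literal.can, Goal.toCmp, Interp.GoalHolds, Interp.LitHolds,
      Interp.AtomHolds]

theorem Interp.goalHolds_neg {M : Interp K R I} {val : ℕ → M.Dom} {g : Goal CmpPred K R I} :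
    M.GoalHolds val g.neg ↔ ¬ M.GoalHolds val g := by
  rcases g with ⟨_ | _, _⟩ | ⟨_ | _, _, _⟩ | ⟨_ | _, _, _⟩ <;>
    simp [Goal.neg, PName.neg, Interp.GoalHolds]

theorem Interp.term_subst (M : Interp K R I) (val : ℕ → M.Dom) (θ : Subst I) (t : Term I) :
    M.term val (t.subst θ) = M.term (fun x => M.term val (θ x)) t := by
  cases t <;> rfl

theorem Interp.goalHolds_subst {M : Interp K R I} {val : ℕ → M.Dom} {θ : Subst I}
    {g : Goal CmpPred K R I} :
    M.GoalHolds val (g.subst θ) ↔ M.GoalHolds (fun x => M.term val (θ x)) g := by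
  rcases g with ⟨_ | _, _⟩ | ⟨_ | _, _, _⟩ | ⟨_ | _, _, _⟩ <;>
    simp [Goal.subst, Interp.GoalHolds, Interp.term_subst]

/-- `c` is the clause of the program that belongs to the literal `L` of `l₁ ++ L :: l₂`. -/
structure IsClauseFor (c : HornClause CmpPred K R I) (l₁ : List (Literal K R I))
    (L : Literal K R I) (l₂ : List (Literal K R I)) : Prop where
  head : c.head = L.goal
  body : c.body.Perm ((l₁ ++ l₂).map fun L' => L'.goal.neg)
  binaryFirst : BinaryFirst c

theorem IsClauseFor.mem_body {c : HornClause CmpPred K R I} {l₁ l₂ : List (Literal K R I)}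
    {L : Literal K R I} (h : IsClauseFor c l₁ L l₂) {b : Goal CmpPred K R I} :
    b ∈ c.body ↔ ∃ L' ∈ l₁ ++ l₂, L'.goal.neg = b := by
  rw [h.body.mem_iff, List.mem_map]

theorem isOrdering_iff {c : HornClause CmpPred K R I} {l₁ l₂ : List (Literal K R I)}
    {L : Literal K R I} :
    IsOrdering ⟨L.can, (l₁ ++ l₂).map fun L' => L'.neg.can⟩ c ↔ IsClauseFor c l₁ L l₂ := by
  have : (((l₁ ++ l₂).map fun L' => L'.neg.can).map Goal.toCmp) =
      (l₁ ++ l₂).map fun L' => L'.goal.neg := by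
    rw [List.map_map]
    exact List.map_congr_left fun L' _ => L'.goal_neg
  constructor
  · rintro ⟨h₁, h₂, h₃⟩; exact ⟨h₁, this ▸ h₂, h₃⟩
  · rintro ⟨h₁, h₂, h₃⟩; exact ⟨h₁, this.symm ▸ h₂, h₃⟩

variable {S : Set (Clause K R I)} {P : List (HornClause CmpPred K R I)}

theorem IsDLogProgram.exists_literal (hP : IsDLogProgram S P) {c : HornClause CmpPred K R I}
    (hc : c ∈ P) : ∃ l₁ L l₂, l₁ ++ L :: l₂ ∈ S ∧ ¬ L.IsEq ∧ (L.IsBinary → L.pos = true) ∧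
      IsClauseFor c l₁ L l₂ := by
  obtain ⟨d, ⟨C, hC, l₁, L, l₂, rfl, hL, rfl⟩, hd, hcd⟩ := hP.1 c hc
  refine ⟨l₁, L, l₂, hC, hL, fun hb => ?_, isOrdering_iff.1 hcd⟩
  by_contra hpos
  exact hd (Literal.isNegBinary_can.2 ⟨hb, by simpa using hpos⟩)

theorem IsDLogProgram.exists_clause (hP : IsDLogProgram S P) {l₁ l₂ : List (Literal K R I)}
    {L : Literal K R I} (hC : l₁ ++ L :: l₂ ∈ S) (hL : ¬ L.IsEq)
    (hpos : L.IsBinary → L.pos = true) : ∃ c ∈ P, IsClauseFor c l₁ L l₂ := by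
  obtain ⟨c, hc, hcd⟩ := hP.2 ⟨L.can, (l₁ ++ l₂).map fun L' => L'.neg.can⟩
    ⟨_, hC, l₁, L, l₂, rfl, hL, rfl⟩ fun h => by
      obtain ⟨hb, hf⟩ := Literal.isNegBinary_can.1 h
      simp [hpos hb] at hf
  exact ⟨c, hc, isOrdering_iff.1 hcd⟩

/-- The program clauses hold in the models of `S`. -/
theorem IsDLogProgram.sound (hP : IsDLogProgram S P) {M : Interp K R I} (hM : M.IsModel S)
    {c : HornClause CmpPred K R I} (hc : c ∈ P) (val : ℕ → M.Dom)
    (hbody : ∀ b ∈ c.body, M.GoalHolds val b) : M.GoalHolds val c.head := by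
  obtain ⟨l₁, L, l₂, hC, -, -, hcl⟩ := hP.exists_literal hc
  obtain ⟨L', hL', hholds⟩ := hM _ hC val
  rw [hcl.head, Interp.goalHolds_goal]
  by_cases h : L' ∈ l₁ ++ l₂
  · have := hbody _ (hcl.mem_body.2 ⟨L', h, rfl⟩)
    exact absurd (Interp.goalHolds_goal.2 hholds) (Interp.goalHolds_neg.1 this)
  · have : L' = L := by
      simp only [List.mem_append, List.mem_cons, not_or] at hL' h
      tauto
    exact this ▸ hholds

theorem mem_left_of_append_eq {α : Type*} {l₁ l₂ m₁ m₂ : List α} {a b : α}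
    (h : m₁ ++ a :: m₂ = l₁ ++ b :: l₂) (hab : a ≠ b) (hb : b ∉ m₁) : a ∈ l₁ := by
  rcases List.append_eq_append_iff.1 h with ⟨l, rfl, hl⟩ | ⟨l, rfl, hl⟩
  · cases l with
    | nil => simp_all
    | cons x l => simp_all
  · cases l with
    | nil => simp_all
    | cons x l => simp_all

/-- The only place where the binary-first rule enters. A positive binary head falls under (p4), a
unary head beside a binary literal under (p3), and a unary head in a clause without binary literals
under (p2). -/
theorem IsDLogProgram.clauseShape (hDL : ∀ C ∈ S, IsDLClause C) (hP : IsDLogProgram S P)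
    {c : HornClause CmpPred K R I} (hc : c ∈ P) : ClauseShape c := by
  obtain ⟨l₁, L, l₂, hC, hLeq, hLpos, hcl⟩ := hP.exists_literal hc
  have hdl := hDL _ hC
  have hhead : c.head.vars = L.vars := by rw [hcl.head, L.vars_goal]
  have hbody_vars : ∀ b ∈ c.body, ∀ x ∈ b.vars, x ∈ litVars (l₁ ++ L :: l₂) := by
    intro b hb x hx
    obtain ⟨L', hL', rfl⟩ := hcl.mem_body.1 hb
    rw [Goal.vars_neg, Literal.vars_goal] at hx
    refine mem_litVars.2 ⟨L', ?_, hx⟩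
    simp only [List.mem_append, List.mem_cons] at hL' ⊢
    tauto
  have hhead_vars : ∀ x ∈ c.head.vars, x ∈ litVars (l₁ ++ L :: l₂) := fun x hx =>
    mem_litVars.2 ⟨L, by simp, hhead ▸ hx⟩
  by_cases hLb : L.IsBinary
  · obtain ⟨hneg, hvars⟩ := hdl.p4 l₁ L l₂ rfl hLb (hLpos hLb)
    refine .role (hcl.head ▸ Literal.isBinary_goal.2 hLb) ?_ ?_
    · intro b hb
      obtain ⟨L', hL', rfl⟩ := hcl.mem_body.1 hb
      exact Goal.isBinary_neg.2 (Literal.isBinary_goal.2 (hneg L' hL').1)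
    · intro x
      rw [hhead, ← hvars, mem_litVars]
      constructor
      · rintro ⟨L', hL', hx⟩
        exact ⟨_, hcl.mem_body.2 ⟨L', hL', rfl⟩, by rwa [Goal.vars_neg, Literal.vars_goal]⟩
      · rintro ⟨b, hb, hx⟩
        obtain ⟨L', hL', rfl⟩ := hcl.mem_body.1 hb
        exact ⟨L', hL', by rwa [Goal.vars_neg, Literal.vars_goal] at hx⟩
  have hLu : L.IsUnary := (Literal.isUnary_or_isBinary hLeq).resolve_right hLb
  have hhu : c.head.IsUnary := hcl.head ▸ Literal.isUnary_goal.2 hLu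
  by_cases hbin : ∃ B ∈ l₁ ++ L :: l₂, B.IsBinary
  · have hcover : ∀ x ∈ litVars (l₁ ++ L :: l₂), ∃ g ∈ c.body, g.IsBinary ∧ x ∈ g.vars := by
      intro x hx
      obtain ⟨B, hB, hBb, hx⟩ := hdl.p3 hbin x hx
      have hB' : B ∈ l₁ ++ l₂ := by
        have : B ≠ L := by rintro rfl; exact hLb hBb
        simp only [List.mem_append, List.mem_cons] at hB ⊢
        tauto
      exact ⟨_, hcl.mem_body.2 ⟨B, hB', rfl⟩,
        Goal.isBinary_neg.2 (Literal.isBinary_goal.2 hBb),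
        by rwa [Goal.vars_neg, Literal.vars_goal]⟩
    refine .connected hhu ?_ ?_
    · intro m₁ b m₂ hm hb x hx
      obtain ⟨g, hg, hgb, hxg⟩ := hcover x (hbody_vars b (by simp [hm]) x hx)
      have hpw := hcl.binaryFirst.1
      -- Part (1) of the rule forbids that the binary goal covering `x` stands to the right of `b`.
      rw [hm] at hg hpw
      rcases List.mem_append.1 hg with hg | hg
      · exact ⟨g, hg, hgb, hxg⟩
      · rcases List.mem_cons.1 hg with rfl | hg
        · exact absurd hgb hb
        · exact absurd hxg
            ((List.pairwise_cons.1 (List.pairwise_append.1 hpw).2.1).1 g hg hb hgb x hx)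
    · intro m₁ b m₂ hm hb x hx
      obtain ⟨n₁, g, n₂, hn, hgb, hxg, hn₁⟩ :=
        hcl.binaryFirst.2 x hx (hcover x (hhead_vars x hx))
      refine ⟨g, mem_left_of_append_eq (hn.symm.trans hm) ?_ fun hmem => hn₁ b hmem hb, hgb, hxg⟩
      rintro rfl
      obtain ⟨_, _, h₁⟩ := hb
      obtain ⟨_, _, _, h₂⟩ := hgb
      simp [h₁] at h₂
  · rcases hdl.p2 with h | h | ⟨hlit, hlen⟩
    · exact absurd h hbin
    · refine .connected hhu (fun m₁ b m₂ hm _ x hx => ?_) (fun _ _ _ _ _ x hx => ?_)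
      · have := hbody_vars b (by simp [hm]) x hx
        simp [h] at this
      · have := hhead_vars x hx
        simp [h] at this
    · obtain ⟨x, hx⟩ := List.length_eq_one_iff.1 hlen
      have key : ∀ L' ∈ l₁ ++ L :: l₂, ∃ q, L'.goal = .unary q (.var x) := by
        intro L' hL'
        have hu : L'.goal.IsUnary := Literal.isUnary_goal.2 <|
          (Literal.isUnary_or_isBinary (hlit L' hL').2).resolve_right fun hb =>
            hbin ⟨L', hL', hb⟩
        obtain ⟨q, t, hqt⟩ := hu
        have hvar : ∃ y, t = .var y := by
          refine (hlit L' hL').1 t ?_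
          rcases L' with ⟨_ | _, _ | _ | _⟩ <;>
            simp_all [Literal.goal, Literal.can, Goal.toCmp, Atom.args]
        obtain ⟨y, rfl⟩ := hvar
        have hy : y ∈ litVars (l₁ ++ L :: l₂) :=
          mem_litVars.2 ⟨L', hL', by rw [← L'.vars_goal, hqt]; simp [Goal.vars, Goal.args,
            Term.vars]⟩
        rw [hx, List.mem_singleton] at hy
        exact ⟨q, hy ▸ hqt⟩
      obtain ⟨p, hp⟩ := key L (by simp)
      refine .uniform p x (hcl.head.trans hp) fun b hb => ?_
      obtain ⟨L', hL', rfl⟩ := hcl.mem_body.1 hb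
      obtain ⟨q, hq⟩ := key L' (by
        simp only [List.mem_append, List.mem_cons] at hL' ⊢
        tauto)
      exact ⟨q.neg, by rw [hq]; rfl⟩

end Program

/-! ## Soundness -/

section Soundness

variable {K : Type u} {R : Type v} {I : Type w} [DecidableEq K] [DecidableEq R] [DecidableEq I]

/-- If a branch below `f` succeeds with the substitution `η`, then `S` entails that each goal of
`f` or one of its ancestors holds under `η`; moreover `η` grounds the binary goals. -/
theorem Yields.sound {Γ : Signature K R I} {B : ℕ} {P : List (HornClause CmpPred K R I)}
    (hadm : AdmissibleProgram Γ B P) {S : Set (Clause K R I)} (hP : IsDLogProgram S P)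
    {f : Frame K R I} {ts : List (Term I)} (h : Yields P f ts) {w : ℕ}
    (hf : f.Admissible Γ B w) :
    ∃ η : Subst I, ts = f.answer.map (Term.subst η) ∧ ∀ ga ∈ f.goals,
      (∀ M : Interp K R I, M.IsModel S → ∀ val : ℕ → M.Dom,
        M.GoalHolds val (ga.1.subst η) ∨ ∃ a ∈ ga.2, M.GoalHolds val (a.subst η)) ∧
      (ga.1.IsBinary → ∀ x, x ∉ (ga.1.subst η).vars) := by
  induction h generalizing w with
  | done ans n =>
    have : (Term.subst Term.var : Term I → _) = id := funext Term.subst_var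
    exact ⟨Term.var, by simp [this], by simp⟩
  | @step g anc gs ans n f' ts hf' _ ih =>
    obtain ⟨w', -, hadm'⟩ := hf.step hadm hf'
    obtain ⟨η, rfl, hη⟩ := ih hadm'
    obtain ⟨k, hk⟩ := AdmissibleList.head hf.goals
    by_cases hg : g.IsUnary ∨ g.IsBinary
    · obtain ⟨hanc, hstep | ⟨c, hc, hstep⟩⟩ := (mem_alternatives hg).1 hf'
      · obtain ⟨⟨p, t, rfl⟩, -⟩ := mem_ancestorStep hstep
        rw [hk.ancestorStep] at hstep
        split_ifs at hstep with hmem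
        · rw [List.mem_singleton.1 hstep] at hη ⊢
          refine ⟨η, rfl, fun ga hga => ?_⟩
          rcases List.mem_cons.1 hga with rfl | hga
          · refine ⟨fun M hM val => ?_, fun hb => by simp [Goal.IsBinary] at hb⟩
            -- If the goal is false, then its complement, which is one of the ancestors, is true.
            refine or_iff_not_imp_left.2 fun hnot => ⟨_, hmem, ?_⟩
            have := Interp.goalHolds_neg.2 hnot
            rwa [Goal.neg_subst] at this
          · exact hη ga hga
        · simp at hstep
      · obtain ⟨θ, hθ, rfl⟩ := clauseStep_eq_some.1 hstep
        have hunif : g.subst θ = c.head.subst fun x => θ (x + n) := by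
          rw [Goal.mgu_unifies hθ, HornClause.rename_head_subst]
        have hbody : ∀ b ∈ c.body, ((b.subst fun x => θ (x + n)),
            (g :: anc).map (Goal.subst θ)) ∈ (c.body.map (Goal.subst fun x => θ (x + n))).map
              (fun b => (b, (g :: anc).map (Goal.subst θ))) ++
              gs.map fun ga => (ga.1.subst θ, ga.2.map (Goal.subst θ)) := fun b hb =>
          List.mem_append_left _ (List.mem_map.2 ⟨_, List.mem_map_of_mem hb, rfl⟩)
        refine ⟨fun x => (θ x).subst η, ?_, fun ga hga => ?_⟩
        · simp [Function.comp_def, Term.subst_subst]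
        rcases List.mem_cons.1 hga with rfl | hga
        · dsimp only
          rw [← Goal.subst_subst, hunif]
          constructor
          · intro M hM val
            -- If the goal and its ancestors all fail, no body goal can be excused by an ancestor.
            -- Then the body holds, and with it the head.
            by_contra hcon
            push Not at hcon
            obtain ⟨hhead, hnone⟩ := hcon
            refine hhead ?_
            rw [Goal.subst_subst, Interp.goalHolds_subst]
            refine hP.sound hM hc _ fun b hb => ?_
            rw [← Interp.goalHolds_subst, ← Goal.subst_subst]
            refine ((hη _ (hbody b hb)).1 M hM val).resolve_right ?_
            rintro ⟨a, ha, hholds⟩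
            obtain ⟨a, ha', rfl⟩ := List.mem_map.1 ha
            rcases List.mem_cons.1 ha' with rfl | ha'
            · exact hhead (hunif ▸ hholds)
            · exact hnone a ha' (by rwa [← Goal.subst_subst])
          · intro hgb x hx
            have hhb : c.head.IsBinary := by
              rw [← Goal.isBinary_subst (θ := fun x => θ (x + n)), ← hunif, Goal.isBinary_subst]
              exact hgb
            obtain ⟨y, hy, hx⟩ := Goal.mem_vars_subst.1 hx
            obtain ⟨z, hz, hy⟩ := Goal.mem_vars_subst.1 hy
            -- Each head variable of a role clause occurs in a body goal, which is ground by
            -- induction; a role fact without body has no variables at all.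
            cases (hadm.2 c hc).1 with
            | role _ hb hv =>
              obtain ⟨b, hbm, hz⟩ := (hv z).1 hz
              exact (hη _ (hbody b hbm)).2 (Goal.isBinary_subst.2 (hb b hbm)) x
                (Goal.mem_vars_subst.2 ⟨y, Goal.mem_vars_subst.2 ⟨z, hz, hy⟩, hx⟩)
            | connected hu =>
              obtain ⟨_, _, h₁⟩ := hu; obtain ⟨_, _, _, h₂⟩ := hhb; simp [h₁] at h₂
            | uniform p x hu => obtain ⟨_, _, _, h₂⟩ := hhb; simp [hu] at h₂
        · have := hη _ (List.mem_append_right _ (List.mem_map_of_mem hga))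
          simpa [Goal.subst_subst, Goal.isBinary_subst] using this
    · cases g with
      | test e s t =>
        simp only [alternatives] at hf'
        split_ifs at hf' with heval
        · rw [List.mem_singleton.1 hf'] at hη ⊢
          refine ⟨η, rfl, fun ga hga => ?_⟩
          rcases List.mem_cons.1 hga with rfl | hga
          · refine ⟨fun M hM val => .inl ?_, fun hb => absurd (.inr hb) hg⟩
            -- Admissibility makes a selected comparison ground. Under the Unique Name Assumption,
            -- syntactic comparison of constants then agrees with equality.
            obtain ⟨a, rfl⟩ := Term.exists_const_of_vars (t := s) fun x hx =>
              hk x (Goal.mem_vars.2 ⟨_, by simp [Goal.args], hx⟩)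
            obtain ⟨b, rfl⟩ := Term.exists_const_of_vars (t := t) fun x hx =>
              hk x (Goal.mem_vars.2 ⟨_, by simp [Goal.args], hx⟩)
            cases e <;>
              simp_all [CmpPred.eval, Goal.subst, Term.subst, Interp.GoalHolds, Interp.term,
                M.const_injective.eq_iff]
          · exact hη ga hga
        · simp at hf'
      | unary p t => exact absurd (.inl ⟨p, t, rfl⟩) hg
      | binary r s t => exact absurd (.inr ⟨r, s, t, rfl⟩) hg

end Soundness

/-! ## Reduced form -/

section ReducedForm

variable {K : Type u} {R : Type v} {I : Type w} {S : Set (Clause K R I)}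

/-- No predicate that occurs in a reduced set is a top predicate. -/
theorem InReducedForm.not_isTop (h : InReducedForm S) (p : K) : ¬ IsTop S p := by
  rintro ⟨⟨C', hC', L, hL, t, hLp⟩, hent⟩
  obtain ⟨S₀, -, rfl⟩ := h
  -- The deleted literals are false in every model of `S₀`. Hence a top predicate of the reduced
  -- form is already one of `S₀`, and those no longer occur.
  have hmodel : ∀ M : Interp K R I, M.IsModel S₀ → M.IsModel (reducedForm S₀) := by
    rintro M hM _ ⟨C, hC, hpos, rfl⟩ val
    obtain ⟨L, hL, hholds⟩ := hM C hC val
    refine ⟨L, List.mem_filter.2 ⟨hL, ?_⟩, hholds⟩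
    simp only [decide_eq_true_eq]
    rintro ⟨hneg, q, s, hq, htop⟩
    obtain ⟨L', hL', hq'⟩ := htop.2 M hM fun _ => M.term val s
    rw [List.mem_singleton.1 hL'] at hq'
    simp only [Interp.LitHolds, hneg, hq, Bool.false_eq_true, if_false, Interp.AtomHolds] at hholds
    exact hholds (by simpa [Interp.LitHolds, Interp.AtomHolds, Interp.term] using hq')
  obtain ⟨C, hC, hpos, rfl⟩ := hC'
  obtain ⟨hLC, hfilter⟩ := List.mem_filter.1 hL
  have htop : L.RefersToTop S₀ :=
    ⟨p, t, hLp, ⟨C, hC, L, hLC, t, hLp⟩, fun M hM => hent M (hmodel M hM)⟩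
  simp only [decide_eq_true_eq] at hfilter
  cases hb : L.pos with
  | true => exact hpos L hLC hb htop
  | false => exact hfilter ⟨hb, htop⟩

/-- A consistent set in reduced form does not entail that a concept holds everywhere. -/
theorem InReducedForm.not_entails (h : InReducedForm S) (hcons : Consistent S) (p : K) :
    ¬ Entails S [⟨true, .unary p (.var 0)⟩] := by
  classical
  intro hent
  refine h.not_isTop p ⟨?_, hent⟩
  by_contra hocc
  push Not at hocc
  obtain ⟨M, hM⟩ := hcons
  -- As `p` does not occur in `S`, its extension can be emptied without losing the model.
  let M' : Interp K R I := { M with concept := fun q d => q ≠ p ∧ M.concept q d }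
  have hM' : M'.IsModel S := by
    intro C hC val
    obtain ⟨L, hL, hholds⟩ := hM C hC val
    refine ⟨L, hL, ?_⟩
    have hterm : ∀ t, M'.term val t = M.term val t := fun t => by cases t <;> rfl
    rcases L with ⟨b, ⟨q, t⟩ | ⟨r, s, t⟩ | ⟨s, t⟩⟩
    · have hqp : q ≠ p := by rintro rfl; exact hocc C hC _ hL t rfl
      simpa [Interp.LitHolds, Interp.AtomHolds, hterm, M', hqp] using hholds
    · simpa [Interp.LitHolds, Interp.AtomHolds, hterm] using hholds
    · simpa [Interp.LitHolds, Interp.AtomHolds, hterm] using hholds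
  obtain ⟨d⟩ := M.nonempty
  obtain ⟨L, hL, hholds⟩ := hent M' hM' fun _ => d
  rw [List.mem_singleton.1 hL] at hholds
  simp [Interp.LitHolds, Interp.AtomHolds, M'] at hholds

end ReducedForm

/-! ## Propositional model elimination

A propositional literal is a pair `(a, b)`, which holds under a valuation `v` if `v a = b`. -/

section ModelElimination

variable {α : Type u}

/-- The propositional clause `D` holds under `v`. -/
def SatProp (v : α → Bool) (D : List (α × Bool)) : Prop := ∃ m ∈ D, v m.1 = m.2

/-- Derivations of a literal from the contrapositives of `G`, where each goal differs from its
ancestors, and may be proved by the complement of an ancestor. -/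
inductive ModelElim (G : Set (List (α × Bool))) : List (α × Bool) → α × Bool → Prop
  | ancestor {A : List (α × Bool)} {m : α × Bool} (hm : m ∉ A) (hA : (m.1, !m.2) ∈ A) :
      ModelElim G A m
  | clause {A l₁ l₂ : List (α × Bool)} {m : α × Bool} (hm : m ∉ A) (hG : l₁ ++ m :: l₂ ∈ G)
      (h : ∀ m' ∈ l₁ ++ l₂, ModelElim G (m :: A) (m'.1, !m'.2)) : ModelElim G A m

theorem prod_bool_eq {m m' : α × Bool} (h : m.1 = m'.1) (hne : m ≠ (m'.1, !m'.2)) : m = m' := by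
  obtain ⟨a, b⟩ := m
  obtain ⟨a', b'⟩ := m'
  obtain rfl : a = a' := h
  cases b <;> cases b' <;> simp_all

/-- Model elimination with the loop check is complete for the clauses in `U`, which arise from
clauses in `G` by the deletion of literals in `A`. -/
theorem modelElim_of_finset {G : Set (List (α × Bool))} (n : ℕ) :
    ∀ (U : Finset (List (α × Bool))) (A : List (α × Bool)) (m : α × Bool), U.card = n →
      (∀ D ∈ U, ∃ C ∈ G, (∀ l ∈ D, l ∈ C) ∧ ∀ l ∈ C, l ∈ D ∨ l ∈ A) →
      (∀ a ∈ A, (a.1, !a.2) ∉ A) →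
      (∀ D ∈ U, ∀ l ∈ D, ∀ a ∈ A, l.1 ≠ a.1) → (∀ a ∈ A, m.1 ≠ a.1) →
      (∃ v, ∀ D ∈ U, SatProp v D) → (∀ v, (∀ D ∈ U, SatProp v D) → v m.1 = m.2) →
      ModelElim G A m := by
  classical
  induction n using Nat.strong_induction_on with
  | _ n ih =>
  intro U A m hn hG hA hatoms hm hsat hent
  -- Drop redundant clauses by induction, so that `U` may be taken minimal among the sets entailing
  -- `m`.
  by_cases hred : ∃ D ∈ U, ∀ v, (∀ D' ∈ U.erase D, SatProp v D') → v m.1 = m.2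
  · obtain ⟨D, hD, hent'⟩ := hred
    obtain ⟨v, hv⟩ := hsat
    exact ih _ (hn ▸ Finset.card_erase_lt_of_mem hD) (U.erase D) A m rfl
      (fun D' hD' => hG D' (Finset.mem_of_mem_erase hD')) hA
      (fun D' hD' => hatoms D' (Finset.mem_of_mem_erase hD')) hm
      ⟨v, fun D' hD' => hv D' (Finset.mem_of_mem_erase hD')⟩ hent'
  push Not at hred
  obtain ⟨v, hv⟩ := hsat
  have hvm := hent v hv
  -- Flipping `m` in a model of `U` must break some clause. That clause contains `m` but not its
  -- complement, and is the one to resolve with.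
  obtain ⟨C', hC', hfalse⟩ : ∃ C' ∈ U, ¬ SatProp (Function.update v m.1 (!m.2)) C' := by
    by_contra! hcon
    have := hent _ hcon
    simp at this
  have hmC' : m ∈ C' := by
    obtain ⟨l, hl, hvl⟩ := hv C' hC'
    by_cases hlm : l.1 = m.1
    · have : l = m := Prod.ext hlm (by rw [← hvl, hlm, hvm])
      exact this ▸ hl
    · exact absurd ⟨l, hl, by rw [Function.update_of_ne hlm]; exact hvl⟩ hfalse
  have hnegC' : (m.1, !m.2) ∉ C' := fun h => hfalse ⟨_, h, by simp⟩
  -- Minimality gives a model of the other clauses in which `m` is false; it keeps the reduced set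
  -- below satisfiable.
  obtain ⟨w, hw, hwm⟩ := hred C' hC'
  obtain ⟨C, hC, hsub, hsup⟩ := hG C' hC'
  have hmA : m ∉ A := fun h => hm m h rfl
  have hA' : ∀ a ∈ m :: A, (a.1, !a.2) ∉ m :: A := by
    intro a ha hmem
    rcases List.mem_cons.1 ha with rfl | ha
    · rcases List.mem_cons.1 hmem with h | h
      · have := congrArg Prod.snd h
        simp at this
      · exact hm _ h rfl
    · rcases List.mem_cons.1 hmem with h | h
      · exact hm a ha (congrArg Prod.fst h).symm
      · exact hA a ha h
  obtain ⟨l₁, l₂, rfl⟩ := List.append_of_mem (hsub m hmC')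
  refine .clause hmA hC fun m' hm' => ?_
  have hm'C : m' ∈ l₁ ++ m :: l₂ := by
    simp only [List.mem_append, List.mem_cons] at hm' ⊢
    tauto
  -- A literal deleted earlier, or a repetition of `m`, gives a subgoal whose complement is an
  -- ancestor.
  by_cases hm'A : m' ∈ m :: A
  · exact .ancestor (hA' m' hm'A) (by simpa using hm'A)
  obtain ⟨hne, hm'A'⟩ : m' ≠ m ∧ m' ∉ A := by simpa using hm'A
  have hm'C' : m' ∈ C' := (hsup m' hm'C).resolve_right hm'A'
  have hatom : ∀ l : α × Bool, l ≠ m → l ≠ (m.1, !m.2) → l.1 ≠ m.1 :=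
    fun l h₁ h₂ h => h₁ (prod_bool_eq h h₂)
  have hm'm : m'.1 ≠ m.1 := hatom m' hne fun h => hnegC' (h ▸ hm'C')
  -- `U'` is `U` without `C'`, simplified under the assumption that `m` is false. It has fewer
  -- clauses and no longer mentions the atom of `m`.
  set U' := ((U.erase C').filter fun D => (m.1, !m.2) ∉ D).image
    fun D => D.filter (· ≠ m) with hU'
  have hmemU' : ∀ D'' ∈ U', ∃ D ∈ U, D ≠ C' ∧ (m.1, !m.2) ∉ D ∧ D.filter (· ≠ m) = D'' := by
    intro D'' hD''
    simp only [hU', Finset.mem_image, Finset.mem_filter, Finset.mem_erase] at hD''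
    obtain ⟨D, ⟨⟨h₁, h₂⟩, h₃⟩, h₄⟩ := hD''
    exact ⟨D, h₂, h₁, h₃, h₄⟩
  have hcard : U'.card < n := by
    refine hn ▸ lt_of_le_of_lt Finset.card_image_le ?_
    exact lt_of_le_of_lt (Finset.card_filter_le _ _) (Finset.card_erase_lt_of_mem hC')
  refine ih _ hcard U' (m :: A) (m'.1, !m'.2) rfl ?_ hA' ?_ ?_ ?_ ?_
  · intro D'' hD''
    obtain ⟨D, hD, -, -, rfl⟩ := hmemU' D'' hD''
    obtain ⟨E, hE, h₁, h₂⟩ := hG D hD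
    refine ⟨E, hE, fun l hl => h₁ l (List.mem_of_mem_filter hl), fun l hl => ?_⟩
    by_cases hlm : l = m
    · exact .inr (by simp [hlm])
    · rcases h₂ l hl with h | h
      · exact .inl (List.mem_filter.2 ⟨h, by simpa using hlm⟩)
      · exact .inr (List.mem_cons_of_mem _ h)
  · intro D'' hD'' l hl a ha
    obtain ⟨D, hD, -, hneg, rfl⟩ := hmemU' D'' hD''
    obtain ⟨hlD, hlm⟩ := List.mem_filter.1 hl
    rcases List.mem_cons.1 ha with rfl | ha
    · exact hatom l (by simpa using hlm) fun h => hneg (h ▸ hlD)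
    · exact hatoms D hD l hlD a ha
  · intro a ha
    rcases List.mem_cons.1 ha with rfl | ha
    · exact hm'm
    · exact hatoms C' hC' m' hm'C' a ha
  · refine ⟨w, fun D'' hD'' => ?_⟩
    obtain ⟨D, hD, hDC, -, rfl⟩ := hmemU' D'' hD''
    obtain ⟨l, hl, hwl⟩ := hw D (Finset.mem_erase.2 ⟨hDC, hD⟩)
    refine ⟨l, List.mem_filter.2 ⟨hl, ?_⟩, hwl⟩
    simp only [decide_eq_true_eq]
    rintro rfl
    exact hwm hwl
  · intro x hx
    by_contra hcon
    have hxm' : x m'.1 = m'.2 := (Bool.eq_not.2 hcon).trans (Bool.not_not _)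
    -- If `m'` held in a model of `U'`, making `m` false there would satisfy all of `U`: `C'`
    -- through `m'`, the discarded clauses through the complement of `m`. But `U` entails `m`.
    have := hent (Function.update x m.1 (!m.2)) fun D hD => by
      by_cases hDC : D = C'
      · exact ⟨m', hDC ▸ hm'C', by rw [Function.update_of_ne hm'm]; exact hxm'⟩
      by_cases hneg : (m.1, !m.2) ∈ D
      · exact ⟨_, hneg, by simp⟩
      · obtain ⟨l, hl, hxl⟩ := hx (D.filter (· ≠ m)) (by
          rw [hU']
          exact Finset.mem_image.2 ⟨D, Finset.mem_filter.2
            ⟨Finset.mem_erase.2 ⟨hDC, hD⟩, hneg⟩, rfl⟩)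
        obtain ⟨hlD, hlm⟩ := List.mem_filter.1 hl
        refine ⟨l, hlD, ?_⟩
        rw [Function.update_of_ne (hatom l (by simpa using hlm) fun h => hneg (h ▸ hlD))]
        exact hxl
    simp at this

/-- Compactness of propositional logic. -/
theorem exists_finset_entails {G : Set (List (α × Bool))} {m : α × Bool}
    (hent : ∀ v, (∀ D ∈ G, SatProp v D) → v m.1 = m.2) :
    ∃ U : Finset (List (α × Bool)), ↑U ⊆ G ∧
      ∀ v, (∀ D ∈ U, SatProp v D) → v m.1 = m.2 := by
  classical
  have hlit : ∀ (a : α) (b : Bool), IsClosed {v : α → Bool | v a = b} := fun a b =>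
    isClosed_eq (continuous_apply a) continuous_const
  have hclosed : ∀ D : G, IsClosed {v : α → Bool | SatProp v D.1} := by
    intro D
    have : {v : α → Bool | SatProp v D.1} = ⋃ l ∈ {l | l ∈ D.1}, {v : α → Bool | v l.1 = l.2} := by
      ext v; simp [SatProp]
    rw [this]
    exact (List.finite_toSet D.1).isClosed_biUnion fun l _ => hlit l.1 l.2
  -- Valuations form a compact product of finite discrete spaces, in which every clause defines a
  -- closed set.
  have hcompact : IsCompact {v : α → Bool | v m.1 = !m.2} := (hlit m.1 (!m.2)).isCompact
  obtain ⟨U, hU⟩ := hcompact.elim_finite_subfamily_closed _ hclosed (by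
    rw [Set.eq_empty_iff_forall_notMem]
    rintro v ⟨hv, hvG⟩
    have := hent v fun D hD => Set.mem_iInter.1 hvG ⟨D, hD⟩
    exact Bool.eq_not.1 hv this)
  refine ⟨U.image Subtype.val, by simp, fun v hv => ?_⟩
  by_contra hcon
  have : v ∈ {v : α → Bool | v m.1 = !m.2} ∩ ⋂ D ∈ U, {v : α → Bool | SatProp v D.1} := by
    refine ⟨Bool.eq_not.2 hcon, ?_⟩
    simp only [Set.mem_iInter]
    exact fun D hD => hv _ (Finset.mem_image_of_mem _ hD)
  rw [hU] at this
  exact this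

/-- Completeness of model elimination with the loop check. -/
theorem modelElim_of_entails {G : Set (List (α × Bool))} {m : α × Bool}
    (hsat : ∃ v, ∀ D ∈ G, SatProp v D) (hent : ∀ v, (∀ D ∈ G, SatProp v D) → v m.1 = m.2) :
    ModelElim G [] m := by
  obtain ⟨U, hUG, hU⟩ := exists_finset_entails hent
  obtain ⟨v, hv⟩ := hsat
  exact modelElim_of_finset _ U [] m rfl
    (fun D hD => ⟨D, hUG hD, fun _ h => h, fun _ h => .inl h⟩) (by simp) (by simp) (by simp)
    ⟨v, fun D hD => hv D (hUG hD)⟩ hU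

end ModelElimination

/-! ## Derivations and their lifting to the search tree -/

section Lifting

variable {K : Type u} {R : Type v} {I : Type w} [DecidableEq I]

/-- Derivations of a goal with given ancestors from the instances of program clauses. -/
inductive Proves (P : List (HornClause CmpPred K R I)) :
    List (Goal CmpPred K R I) → Goal CmpPred K R I → Prop
  | test {A : List (Goal CmpPred K R I)} {e : CmpPred} {s t : Term I} (h : e.eval s t = true) :
      Proves P A (.test e s t)
  | ancestor {A : List (Goal CmpPred K R I)} {g : Goal CmpPred K R I} (hg : g.IsUnary)
      (hA : g ∉ A) (hneg : g.neg ∈ A) : Proves P A g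
  | clause {A : List (Goal CmpPred K R I)} {g : Goal CmpPred K R I}
      {c : HornClause CmpPred K R I} {τ : Subst I} (hc : c ∈ P) (hg : g = c.head.subst τ)
      (hA : g ∉ A) (h : ∀ b ∈ c.body, Proves P (g :: A) (b.subst τ)) : Proves P A g

variable [DecidableEq K] [DecidableEq R] {Γ : Signature K R I} {B : ℕ}
  {P : List (HornClause CmpPred K R I)}

/-- If the instances of all goals of a frame under `δ` are derivable, then this holds for one of
its successors, and the instance of the answer is the same. -/
theorem Frame.Admissible.exists_alternative (hadm : AdmissibleProgram Γ B P)
    {g : Goal CmpPred K R I} {anc : List (Goal CmpPred K R I)}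
    {gs : List (Goal CmpPred K R I × List (Goal CmpPred K R I))} {ans : List (Term I)} {n w : ℕ}
    (hf : (⟨(g, anc) :: gs, ans, n⟩ : Frame K R I).Admissible Γ B w) {δ : Subst I}
    (hδ : ∀ ga ∈ (g, anc) :: gs, Proves P (ga.2.map (Goal.subst δ)) (ga.1.subst δ)) :
    ∃ f' ∈ alternatives P g anc ⟨gs, ans, n⟩, ∃ δ' : Subst I,
      (∀ ga ∈ f'.goals, Proves P (ga.2.map (Goal.subst δ')) (ga.1.subst δ')) ∧
        f'.answer.map (Term.subst δ') = ans.map (Term.subst δ) := by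
  obtain ⟨k, hk⟩ := AdmissibleList.head hf.goals
  have hfirst := hδ (g, anc) List.mem_cons_self
  have hrest : ∀ ga ∈ gs, Proves P (ga.2.map (Goal.subst δ)) (ga.1.subst δ) :=
    fun ga hga => hδ ga (List.mem_cons_of_mem _ hga)
  dsimp only at hfirst
  by_cases hg : g.IsUnary ∨ g.IsBinary
  · simp only [mem_alternatives hg]
    generalize hgδ : g.subst δ = g' at hfirst
    cases hfirst with
    | test h => cases g <;> simp_all [Goal.subst, Goal.IsUnary, Goal.IsBinary]
    | ancestor hu hA hneg =>
      subst hgδ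
      have hanc : g ∉ anc := fun h => hA (List.mem_map_of_mem h)
      obtain ⟨p, t, rfl⟩ := Goal.isUnary_subst.1 hu
      -- The complement occurs among the instantiated ancestors. By the invariant it already occurs
      -- before instantiation, so the engine's ancestor step applies and `δ` is unchanged.
      have hmem : Goal.unary p.neg t ∈ anc := by
        obtain ⟨a, ha, haδ⟩ := List.mem_map.1 hneg
        rcases hk.unary.2 with hgr | hun
        · rw [Goal.subst_eq_self (hgr a (List.mem_cons_of_mem _ ha)),
            Goal.subst_eq_self (hgr _ List.mem_cons_self)] at haδ
          rwa [haδ] at ha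
        · obtain ⟨q, rfl⟩ := hun a ha
          have : q = p.neg := (Goal.unary.inj haδ).1
          exact this ▸ ha
      refine ⟨⟨gs, ans, n⟩, ⟨hanc, .inl ?_⟩, δ, hrest, rfl⟩
      rw [hk.ancestorStep, if_pos hmem]
      exact List.mem_singleton_self _
    | @clause _ _ c τ hc hgτ hA hbody =>
      subst hgδ
      have hanc : g ∉ anc := fun h => hA (List.mem_map_of_mem h)
      -- Variables below `n` belong to the frame, the others to the renamed clause. So `δ` and `τ`
      -- combine to a unifier of the goal and the renamed head.
      let δ' : Subst I := fun x => if x < n then δ x else τ (x - n)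
      have hgoal : ∀ h : Goal CmpPred K R I, h.Over Γ n → h.subst δ' = h.subst δ :=
        fun h hh => Goal.subst_congr fun x hx => if_pos (hh.lt hx)
      have hδτ : (fun x => δ' (x + n)) = τ := by
        funext x
        simp [δ']
      have hg_over := hf.goals_over (g, anc) List.mem_cons_self
      obtain ⟨θ, hθ, hθδ⟩ := Goal.exists_mgu (h := (c.rename n).head) hg (δ := δ') (by
        rw [hgoal g hg_over.1, HornClause.rename_head_subst, hδτ, hgτ])
      have hsub : ∀ h : Goal CmpPred K R I, h.Over Γ n →
          (h.subst θ).subst δ' = h.subst δ := fun h hh => by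
        rw [Goal.subst_subst, ← hgoal h hh]
        exact Goal.subst_congr fun x _ => hθδ x
      have hancs : ∀ l : List (Goal CmpPred K R I), (∀ a ∈ l, a.Over Γ n) →
          (l.map (Goal.subst θ)).map (Goal.subst δ') = l.map (Goal.subst δ) := fun l hl => by
        rw [List.map_map]
        exact List.map_congr_left fun a ha => hsub a (hl a ha)
      refine ⟨_, ⟨hanc, .inr ⟨c, hc, clauseStep_eq_some.2 ⟨θ, hθ, rfl⟩⟩⟩, δ', ?_, ?_⟩
      · intro ga hga
        rcases List.mem_append.1 hga with hga | hga
        · obtain ⟨_, hb, rfl⟩ := List.mem_map.1 hga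
          obtain ⟨b, hb', rfl⟩ := List.mem_map.1 hb
          have hbτ : (b.subst fun x => θ (x + n)).subst δ' = b.subst τ := by
            rw [Goal.subst_subst, ← hδτ]
            exact Goal.subst_congr fun x _ => hθδ _
          dsimp only
          rw [hbτ, hancs _ (by simpa using hg_over)]
          exact hbody b hb'
        · obtain ⟨ga, hga', rfl⟩ := List.mem_map.1 hga
          have := hf.goals_over ga (List.mem_cons_of_mem _ hga')
          dsimp only
          rw [hsub _ this.1, hancs _ this.2]
          exact hrest ga hga'
      · rw [List.map_map]
        refine List.map_congr_left fun t ht => ?_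
        rw [Function.comp_apply, Term.subst_subst]
        exact Term.subst_congr fun x hx =>
          (hθδ x).trans (if_pos ((hf.answer t ht).lt hx))
  · cases g with
    | test e s t =>
      refine ⟨⟨gs, ans, n⟩, ?_, δ, hrest, rfl⟩
      obtain ⟨a, rfl⟩ := Term.exists_const_of_vars (t := s) fun x hx =>
        hk x (Goal.mem_vars.2 ⟨_, by simp [Goal.args], hx⟩)
      obtain ⟨b, rfl⟩ := Term.exists_const_of_vars (t := t) fun x hx =>
        hk x (Goal.mem_vars.2 ⟨_, by simp [Goal.args], hx⟩)
      have heval : e.eval (.const a) (.const b) = true := by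
        cases hfirst with
        | test h => exact h
        | ancestor hu => obtain ⟨_, _, h⟩ := hu; cases h
        | @clause _ _ c τ hc hgτ =>
          rcases (hadm.2 c hc).1.head_isUnary_or_isBinary with ⟨_, _, h⟩ | ⟨_, _, _, h⟩ <;>
            simp [h, Goal.subst] at hgτ
      simp [alternatives, heval]
    | unary p t => exact absurd (.inl ⟨p, t, rfl⟩) hg
    | binary r s t => exact absurd (.inr ⟨r, s, t, rfl⟩) hg

/-- The search finds all derivable instances of the goals of a frame. -/
theorem Frame.Admissible.exists_yields (hadm : AdmissibleProgram Γ B P) {w : ℕ}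
    {f : Frame K R I} (hf : f.Admissible Γ B w) {δ : Subst I}
    (hδ : ∀ ga ∈ f.goals, Proves P (ga.2.map (Goal.subst δ)) (ga.1.subst δ)) :
    ∃ ts, Yields P f ts ∧ ∃ θ : Subst I, f.answer.map (Term.subst δ) = ts.map (Term.subst θ) := by
  induction w using Nat.strong_induction_on generalizing f δ with
  | _ w ih =>
  rcases f with ⟨_ | ⟨⟨g, anc⟩, gs⟩, ans, n⟩
  · exact ⟨ans, .done _ _, δ, rfl⟩
  · obtain ⟨f', hf', δ', hδ', hans⟩ := hf.exists_alternative hadm hδ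
    obtain ⟨w', hw', hadm'⟩ := hf.step hadm hf'
    obtain ⟨ts, hts, θ, hθ⟩ := ih w' hw' hadm' hδ'
    exact ⟨ts, .step hf' hts, θ, hans.symm.trans hθ⟩

end Lifting

/-! ## Role facts -/

section Roles

variable {K : Type u} {R : Type v} {I : Type w}

/-- The binary goal `g` has a derivation of height less than `n`. -/
def RoleDerivable (P : List (HornClause CmpPred K R I)) : ℕ → Goal CmpPred K R I → Prop
  | 0, _ => False
  | n + 1, g => g.IsBinary ∧ ∃ c ∈ P, ∃ τ : Subst I, g = c.head.subst τ ∧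
      ∀ b ∈ c.body, RoleDerivable P n (b.subst τ)

/-- The binary goal `g` is derivable from the program. -/
def RoleFact (P : List (HornClause CmpPred K R I)) (g : Goal CmpPred K R I) : Prop :=
  ∃ n, RoleDerivable P n g

variable {P : List (HornClause CmpPred K R I)}

theorem RoleDerivable.succ {n : ℕ} {g : Goal CmpPred K R I} (h : RoleDerivable P n g) :
    RoleDerivable P (n + 1) g := by
  induction n generalizing g with
  | zero => exact h.elim
  | succ n ih =>
    obtain ⟨hb, c, hc, τ, hg, hbody⟩ := h
    exact ⟨hb, c, hc, τ, hg, fun b hb => ih (hbody b hb)⟩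

theorem RoleDerivable.mono {m n : ℕ} (hmn : m ≤ n) {g : Goal CmpPred K R I}
    (h : RoleDerivable P m g) : RoleDerivable P n g := by
  induction n, hmn using Nat.le_induction with
  | base => exact h
  | succ n _ ih => exact ih.succ

theorem RoleDerivable.isBinary {n : ℕ} {g : Goal CmpPred K R I} (h : RoleDerivable P n g) :
    g.IsBinary := by
  cases n with
  | zero => exact h.elim
  | succ n => exact h.1

/-- A body is finite, so its derivations have a common height bound. -/
theorem RoleFact.of_clause {c : HornClause CmpPred K R I} (hc : c ∈ P) (hb : c.head.IsBinary)
    {τ : Subst I} (h : ∀ b ∈ c.body, RoleFact P (b.subst τ)) : RoleFact P (c.head.subst τ) := by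
  have key : ∀ l : List (Goal CmpPred K R I), (∀ b ∈ l, RoleFact P (b.subst τ)) →
      ∃ n, ∀ b ∈ l, RoleDerivable P n (b.subst τ) := by
    intro l
    induction l with
    | nil => exact fun _ => ⟨0, by simp⟩
    | cons b l ih =>
      intro hl
      obtain ⟨n, hn⟩ := ih fun b hb => hl b (List.mem_cons_of_mem _ hb)
      obtain ⟨m, hm⟩ := hl b List.mem_cons_self
      refine ⟨max m n, fun b' hb' => ?_⟩
      rcases List.mem_cons.1 hb' with rfl | hb'
      · exact hm.mono (le_max_left _ _)
      · exact (hn b' hb').mono (le_max_right _ _)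
  obtain ⟨n, hn⟩ := key c.body h
  exact ⟨n + 1, Goal.isBinary_subst.2 hb, c, hc, τ, rfl, hn⟩

/-- Role facts have derivations without loops. -/
theorem RoleDerivable.proves [DecidableEq I] {n : ℕ} {g : Goal CmpPred K R I}
    (h : RoleDerivable P n g) {A : List (Goal CmpPred K R I)}
    (hA : ∀ a ∈ A, ¬ RoleDerivable P n a) : Proves P A g := by
  induction n generalizing g A with
  | zero => exact h.elim
  | succ n ih =>
    have hA' : ∀ a ∈ A, ¬ RoleDerivable P n a := fun a ha hn => hA a ha hn.succ
    -- Descend to the least height at which `g` is derivable. There `g` needs greater height than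
    -- its body goals, so adding it to the ancestors preserves the assumption on `A`.
    by_cases hn : RoleDerivable P n g
    · exact ih hn hA'
    · have hgA : g ∉ A := fun hg => hA g hg h
      obtain ⟨-, c, hc, τ, hg, hbody⟩ := h
      refine .clause hc hg hgA fun b hb => ih (hbody b hb) fun a ha => ?_
      rcases List.mem_cons.1 ha with rfl | ha
      · exact hn
      · exact hA' a ha

theorem RoleFact.proves [DecidableEq I] {g : Goal CmpPred K R I} (h : RoleFact P g)
    {A : List (Goal CmpPred K R I)} (hA : ∀ a ∈ A, ¬ a.IsBinary) : Proves P A g := by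
  obtain ⟨n, hn⟩ := h
  exact hn.proves fun a ha h => hA a ha h.isBinary

theorem RoleFact.sound {S : Set (Clause K R I)} (hP : IsDLogProgram S P) {M : Interp K R I}
    (hM : M.IsModel S) {g : Goal CmpPred K R I} (h : RoleFact P g) (val : ℕ → M.Dom) :
    M.GoalHolds val g := by
  obtain ⟨n, hn⟩ := h
  induction n generalizing g with
  | zero => exact hn.elim
  | succ n ih =>
    obtain ⟨-, c, hc, τ, rfl, hbody⟩ := hn
    rw [Interp.goalHolds_subst]
    refine hP.sound hM hc _ fun b hb => ?_
    rw [← Interp.goalHolds_subst]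
    exact ih (hbody b hb)

end Roles

/-! ## Completeness of ground derivations -/

section Ground

variable {K : Type u} {R : Type v} {I : Type w}

/-- The constant denoted by a term under a ground substitution. -/
def Term.ground (τ : ℕ → I) : Term I → I
  | .var x => τ x
  | .const a => a

theorem Term.subst_const (τ : ℕ → I) (t : Term I) :
    (t.subst fun x => .const (τ x)) = .const (t.ground τ) := by
  cases t <;> rfl

/-- The propositional literal for a ground instance of a unary literal. -/
def Literal.prop (τ : ℕ → I) : Literal K R I → Option ((K × I) × Bool)
  | ⟨b, .unary p t⟩ => some ((p, t.ground τ), b)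
  | _ => none

/-- The goal for a propositional literal. -/
def propGoal (m : (K × I) × Bool) : Goal CmpPred K R I :=
  .unary (if m.2 then .plain m.1.1 else .not_ m.1.1) (.const m.1.2)

theorem Literal.goal_of_prop {τ : ℕ → I} {L : Literal K R I} {m : (K × I) × Bool}
    (h : L.prop τ = some m) : (L.goal.subst fun x => .const (τ x)) = propGoal m := by
  rcases L with ⟨_ | _, ⟨p, t⟩ | _ | _⟩ <;>
    simp only [Literal.prop, Option.some.injEq, reduceCtorEq] at h <;> subst h <;>
    simp [Literal.goal, Literal.can, Goal.toCmp, Goal.subst, propGoal, Term.subst_const]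

theorem Literal.isUnary_of_prop {τ : ℕ → I} {L : Literal K R I} {m : (K × I) × Bool}
    (h : L.prop τ = some m) : L.IsUnary := by
  rcases L with ⟨b, ⟨p, t⟩ | _ | _⟩ <;>
    simp_all [Literal.prop, Literal.IsUnary]

theorem Literal.IsUnary.exists_prop (τ : ℕ → I) {L : Literal K R I} (h : L.IsUnary) :
    ∃ m, L.prop τ = some m := by
  rcases L with ⟨b, ⟨p, t⟩ | _ | _⟩ <;>
    simp_all [Literal.prop, Literal.IsUnary]

theorem propGoal_neg (m : (K × I) × Bool) :
    (propGoal (m.1, !m.2) : Goal CmpPred K R I) = (propGoal m).neg := by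
  rcases m with ⟨_, _ | _⟩ <;> rfl

theorem propGoal_injective :
    Function.Injective (propGoal : (K × I) × Bool → Goal CmpPred K R I) := by
  rintro ⟨⟨p, a⟩, _ | _⟩ ⟨⟨q, b⟩, _ | _⟩ h <;> simp_all [propGoal]

/-- The ground binary goal or comparison `g` succeeds. -/
def Settled [DecidableEq I] (P : List (HornClause CmpPred K R I)) (g : Goal CmpPred K R I) : Prop :=
  RoleFact P g ∨ ∃ e s t, g = .test e s t ∧ CmpPred.eval e s t = true

/-- The propositional clauses that remain from the ground instances of the clauses of `S` when
the binary literals and the (in)equalities are evaluated. -/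
def groundClauses [DecidableEq I] (S : Set (Clause K R I)) (P : List (HornClause CmpPred K R I)) :
    Set (List ((K × I) × Bool)) :=
  {D | ∃ C ∈ S, ∃ τ : ℕ → I,
    (∀ L ∈ C, ¬ L.IsUnary → Settled P (L.goal.neg.subst fun x => .const (τ x))) ∧
      D = C.filterMap (Literal.prop τ)}

/-- The interpretation on the constants with the derivable roles and with concepts given by `v`. -/
def groundInterp (P : List (HornClause CmpPred K R I)) (v : K × I → Bool) (h : Nonempty I) :
    Interp K R I where
  Dom := I
  nonempty := h
  const := id
  const_injective := Function.injective_id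
  concept p a := v (p, a) = true
  role r a b := RoleFact P (.binary (.plain r) (.const a) (.const b))

variable {S : Set (Clause K R I)} {P : List (HornClause CmpPred K R I)}

theorem groundInterp_unary {v : K × I → Bool} {h : Nonempty I} {val : ℕ → I} {p : K}
    {t : Term I} : (groundInterp P v h).GoalHolds val (.unary (.plain p) t) ↔
      v (p, t.ground val) = true := by
  cases t <;> rfl

theorem groundInterp_binary {v : K × I → Bool} {h : Nonempty I} {val : ℕ → I} {r : R}
    {s t : Term I} : (groundInterp P v h).GoalHolds val (.binary (.plain r) s t) ↔
      RoleFact P ((Goal.binary (.plain r) s t).subst fun x => .const (val x)) := by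
  rw [Goal.subst, Term.subst_const, Term.subst_const]
  cases s <;> cases t <;> rfl

theorem groundInterp_ident {v : K × I → Bool} {h : Nonempty I} {val : ℕ → I} {s t : Term I} :
    (groundInterp P v h).GoalHolds val (.test .ident s t) ↔ s.ground val = t.ground val := by
  cases s <;> cases t <;> rfl

theorem groundInterp_prop {v : K × I → Bool} {h : Nonempty I} {val : ℕ → I} {L : Literal K R I}
    {m : (K × I) × Bool} (hm : L.prop val = some m) :
    (groundInterp P v h).GoalHolds val L.goal ↔ v m.1 = m.2 := by
  rcases L with ⟨_ | _, ⟨p, t⟩ | _ | _⟩ <;>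
    simp only [Literal.prop, Option.some.injEq, reduceCtorEq] at hm <;> subst hm
  · exact (Interp.goalHolds_neg (g := .unary (.plain p) t)).trans
      (groundInterp_unary.not.trans (by simp))
  · exact groundInterp_unary

/-- Roles are interpreted by derivability, so positive binary goals that hold are derivable. Negated
ones are excluded because the program has no clauses for them. -/
theorem settled_of_groundInterp [DecidableEq I] {v : K × I → Bool} {h : Nonempty I} {val : ℕ → I}
    {g : Goal CmpPred K R I} (hu : ¬ g.IsUnary) (hneg : ¬ g.IsNegBinary)
    (hg : (groundInterp P v h).GoalHolds val g) :
    Settled P (g.subst fun x => .const (val x)) := by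
  rcases g with _ | ⟨r | r, s, t⟩ | ⟨_ | _, s, t⟩
  · simp [Goal.IsUnary] at hu
  · exact .inl (groundInterp_binary.1 hg)
  · exact absurd ⟨r, s, t, rfl⟩ hneg
  · refine .inr ⟨_, _, _, rfl, ?_⟩
    simpa [CmpPred.eval, Term.subst_const] using groundInterp_ident.1 hg
  · refine .inr ⟨_, _, _, rfl, ?_⟩
    have := (Interp.goalHolds_neg (g := .test .ident s t)).1 hg
    simpa [CmpPred.eval, Term.subst_const, groundInterp_ident] using this

variable [DecidableEq I]

theorem Settled.sound (hP : IsDLogProgram S P) {M : Interp K R I} (hM : M.IsModel S)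
    {τ : ℕ → I} {g : Goal CmpPred K R I} (h : Settled P (g.subst fun x => .const (τ x)))
    (val : ℕ → M.Dom) : M.GoalHolds val (g.subst fun x => .const (τ x)) := by
  rcases h with h | ⟨e, s, t, hg, he⟩
  · exact h.sound hP hM val
  · cases g with
    | unary p t => simp [Goal.subst] at hg
    | binary r s t => simp [Goal.subst] at hg
    | test e' s' t' =>
      obtain ⟨rfl, rfl, rfl⟩ := Goal.test.inj hg
      cases e' <;>
        simp_all [Goal.subst, Term.subst_const, CmpPred.eval, Interp.GoalHolds, Interp.term,
          M.const_injective.eq_iff]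

/-- Valuations that satisfy the ground clauses yield models of `S`. -/
theorem groundInterp_isModel (hDL : ∀ C ∈ S, IsDLClause C) (hP : IsDLogProgram S P)
    {v : K × I → Bool} (hv : ∀ D ∈ groundClauses S P, SatProp v D) (h : Nonempty I) :
    (groundInterp P v h).IsModel S := by
  intro C hC val
  by_contra! hcon
  have hfalse : ∀ L ∈ C, ¬ (groundInterp P v h).GoalHolds val L.goal := fun L hL hh =>
    hcon L hL (Interp.goalHolds_goal.1 hh)
  have hsettled : ∀ L ∈ C, ¬ L.IsUnary → ¬ L.goal.neg.IsNegBinary →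
      Settled P (L.goal.neg.subst fun x => .const (val x)) := fun L hL hu hneg =>
    settled_of_groundInterp (fun hu' => hu (Literal.isUnary_goal.1 (Goal.isUnary_neg.1 hu')))
      hneg (Interp.goalHolds_neg.2 (hfalse L hL))
  have hnegb : ∀ L : Literal K R I, L.goal.neg.IsNegBinary → L.IsBinary ∧ L.pos = true := by
    rintro ⟨_ | _, _ | _ | _⟩ ⟨r, s, t, hr⟩ <;>
      simp_all [Literal.goal, Literal.can, Goal.toCmp, Goal.neg, PName.neg, Literal.IsBinary]
  -- In a clause with a positive binary literal, (p4) leaves only negative binary literals besides.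
  -- If all these fail, their atoms are role facts, and the program clause derives the positive one.
  by_cases hpos : ∃ L ∈ C, L.IsBinary ∧ L.pos = true
  · obtain ⟨L, hL, hLb, hLpos⟩ := hpos
    obtain ⟨l₁, l₂, rfl⟩ := List.append_of_mem hL
    have hLeq : ¬ L.IsEq := by
      obtain ⟨r, s, t, hr⟩ := hLb
      rintro ⟨s', t', hs⟩
      simp [hr] at hs
    obtain ⟨c, hc, hcl⟩ := hP.exists_clause hC hLeq fun _ => hLpos
    have hfact : RoleFact P (c.head.subst fun x => .const (val x)) := by
      refine RoleFact.of_clause hc (hcl.head ▸ Literal.isBinary_goal.2 hLb) fun b hb => ?_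
      obtain ⟨L', hL', rfl⟩ := hcl.mem_body.1 hb
      obtain ⟨hb', hneg'⟩ := ((hDL _ hC).p4 l₁ L l₂ rfl hLb hLpos).1 L' hL'
      have hgb : L'.goal.neg.IsBinary := Goal.isBinary_neg.2 (Literal.isBinary_goal.2 hb')
      have := hsettled L' (by
          simp only [List.mem_append, List.mem_cons] at hL' ⊢
          tauto)
        (fun hu => by
          obtain ⟨_, _, h₁⟩ := hu; obtain ⟨_, _, _, h₂⟩ := hb'; simp [h₁] at h₂)
        fun hn => by simp [(hnegb L' hn).2] at hneg'
      rcases this with hfact | ⟨e, s, t, hg, -⟩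
      · exact hfact
      · obtain ⟨_, _, _, h₂⟩ := hgb
        simp [h₂, Goal.subst] at hg
    refine hfalse L hL ?_
    obtain ⟨r, s, t, hL'⟩ : ∃ r s t, L.goal = .binary (.plain r) s t := by
      rcases L with ⟨_ | _, _ | _ | _⟩ <;>
        simp_all [Literal.goal, Literal.can, Goal.toCmp, Literal.IsBinary]
    rw [hcl.head, hL'] at hfact
    rw [hL']
    exact groundInterp_binary.2 hfact
  -- Otherwise every non-unary literal is refuted by a settled goal, so the unary rest is one of the
  -- ground clauses satisfied by `v`.
  · obtain ⟨m, hm, hvm⟩ := hv (C.filterMap (Literal.prop val)) ⟨C, hC, val, fun L hL hu =>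
      hsettled L hL hu fun hn => hpos ⟨L, hL, hnegb L hn⟩, rfl⟩
    obtain ⟨L, hL, hLm⟩ := List.mem_filterMap.1 hm
    exact hfalse L hL ((groundInterp_prop hLm).2 hvm)

/-- The ground clauses of a consistent set are satisfiable. -/
theorem exists_satProp (hP : IsDLogProgram S P) (hcons : Consistent S) :
    ∃ v, ∀ D ∈ groundClauses S P, SatProp v D := by
  classical
  obtain ⟨M, hM⟩ := hcons
  -- Read the valuation off any model at the named elements. Settled goals hold in that model, so a
  -- unary literal must satisfy the clause.
  refine ⟨fun q => decide (M.concept q.1 (M.const q.2)), ?_⟩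
  rintro _ ⟨C, hC, τ, hsettled, rfl⟩
  obtain ⟨L, hL, hholds⟩ := hM C hC fun x => M.const (τ x)
  have hgoal : M.GoalHolds (fun x => M.const (τ x)) (L.goal.subst fun x => .const (τ x)) :=
    Interp.goalHolds_subst.2 (Interp.goalHolds_goal.2 hholds)
  by_cases hu : L.IsUnary
  · obtain ⟨m, hm⟩ := hu.exists_prop τ
    refine ⟨m, List.mem_filterMap.2 ⟨L, hL, hm⟩, ?_⟩
    rw [Literal.goal_of_prop hm] at hgoal
    rcases m with ⟨q, _ | _⟩ <;> simpa [propGoal, Interp.GoalHolds, Interp.term] using hgoal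
  · have := (hsettled L hL hu).sound hP hM fun x => M.const (τ x)
    rw [← Goal.neg_subst] at this
    exact absurd hgoal (Interp.goalHolds_neg.1 this)

/-- Model elimination derivations from the ground clauses are derivations from the program. -/
theorem ModelElim.proves (hP : IsDLogProgram S P) {A : List ((K × I) × Bool)}
    {m : (K × I) × Bool} (h : ModelElim (groundClauses S P) A m) :
    Proves P (A.map propGoal) (propGoal m) := by
  induction h with
  | @ancestor A m hm hA =>
    refine .ancestor ⟨_, _, rfl⟩ (fun h => ?_) ?_
    · obtain ⟨m', hm', heq⟩ := List.mem_map.1 h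
      exact hm (propGoal_injective heq ▸ hm')
    · rw [← propGoal_neg]
      exact List.mem_map_of_mem hA
  | @clause A l₁ l₂ m hm hG _ ih =>
    obtain ⟨C, hC, τ, hsettled, hD⟩ := hG
    obtain ⟨C₁, C', rfl, rfl, hC'⟩ := List.filterMap_eq_append_iff.1 hD.symm
    -- This recovers the literal `L` behind `m` in the original clause. The literals of `N` were
    -- erased by the projection and hence are not unary.
    obtain ⟨N, L, C₂, rfl, hN, hL, rfl⟩ := List.filterMap_eq_cons_iff.1 hC'
    have hC'' : (C₁ ++ N) ++ L :: C₂ ∈ S := by simpa using hC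
    have hLu := Literal.isUnary_of_prop hL
    obtain ⟨c, hc, hcl⟩ := hP.exists_clause hC''
      (by obtain ⟨_, _, h₁⟩ := hLu; rintro ⟨_, _, h₂⟩; simp [h₁] at h₂)
      (by obtain ⟨_, _, h₁⟩ := hLu; rintro ⟨_, _, _, h₂⟩; simp [h₁] at h₂)
    refine .clause (τ := fun x => .const (τ x)) hc
      (by rw [hcl.head, Literal.goal_of_prop hL]) (fun h => ?_) fun b hb => ?_
    · obtain ⟨m', hm', heq⟩ := List.mem_map.1 h
      exact hm (propGoal_injective heq ▸ hm')
    · obtain ⟨L', hL', rfl⟩ := hcl.mem_body.1 hb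
      by_cases hu : L'.IsUnary
      · obtain ⟨m', hm'⟩ := hu.exists_prop τ
        have hmem : m' ∈ C₁.filterMap (Literal.prop τ) ++ C₂.filterMap (Literal.prop τ) := by
          rw [← List.filterMap_append]
          refine List.mem_filterMap.2 ⟨L', ?_, hm'⟩
          have hLN : L' ∉ N := fun h => by simp [hN L' h] at hm'
          simp only [List.mem_append] at hL' ⊢
          tauto
        have := ih m' hmem
        rw [propGoal_neg, ← Literal.goal_of_prop hm'] at this
        rw [← Goal.neg_subst]
        exact this
      · rcases hsettled L' (by
            simp only [List.mem_append, List.mem_cons] at hL' ⊢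
            tauto) hu with hfact | ⟨e, s, t, hg, he⟩
        · refine hfact.proves fun a ha => ?_
          obtain ⟨m', -, rfl⟩ := List.mem_map.1 (show a ∈ (m :: A).map propGoal from ha)
          simp [propGoal, Goal.IsBinary]
        · rw [hg]
          exact .test he

/-- Ground literals of queries that follow from `S` are derivable. -/
theorem proves_of_entails (hDL : ∀ C ∈ S, IsDLClause C) (hcons : Consistent S)
    (hP : IsDLogProgram S P) {L : Literal K R I} (hL : L.IsUnary ∨ L.IsBinary ∧ L.pos = true)
    (hground : ∀ x, x ∉ L.vars)
    (hent : ∀ M : Interp K R I, M.IsModel S → ∀ val : ℕ → M.Dom, M.LitHolds val L) :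
    Proves P [] L.goal := by
  -- A ground literal contains a constant, so the domain of the ground interpretation is nonempty.
  have hI : Nonempty I := by
    rcases L with ⟨b, ⟨p, t⟩ | ⟨r, s, t⟩ | _⟩
    · obtain ⟨a, -⟩ := Term.exists_const_of_vars (t := t) fun x hx =>
        hground x (by simp [Literal.vars, Atom.args, hx])
      exact ⟨a⟩
    · obtain ⟨a, -⟩ := Term.exists_const_of_vars (t := t) fun x hx =>
        hground x (by simp [Literal.vars, Atom.args, hx])
      exact ⟨a⟩
    · simp [Literal.IsUnary, Literal.IsBinary] at hL
  obtain ⟨a⟩ := id hI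
  have hsubst : (L.goal.subst fun _ => .const a) = L.goal :=
    Goal.subst_eq_self fun x hx => hground x (L.vars_goal ▸ hx)
  have hholds : ∀ v : K × I → Bool, (∀ D ∈ groundClauses S P, SatProp v D) →
      (groundInterp P v hI).GoalHolds (fun _ => a) L.goal := fun v hv =>
    Interp.goalHolds_goal.2 (hent _ (groundInterp_isModel hDL hP hv hI) _)
  rcases hL with hu | ⟨hb, hpos⟩
  · obtain ⟨m, hm⟩ := hu.exists_prop fun _ => a
    have := (modelElim_of_entails (exists_satProp hP hcons) fun v hv =>
      (groundInterp_prop hm).1 (hholds v hv)).proves hP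
    rwa [← Literal.goal_of_prop hm, hsubst] at this
  -- For a binary literal any satisfying valuation will do, since roles do not depend on it.
  · obtain ⟨v, hv⟩ := exists_satProp hP hcons
    have hgb : L.goal.IsBinary := Literal.isBinary_goal.2 hb
    have hset := settled_of_groundInterp (g := L.goal)
      (fun hu => by obtain ⟨_, _, h₁⟩ := hu; obtain ⟨_, _, _, h₂⟩ := hgb; simp [h₁] at h₂)
      (fun hn => by
        rcases L with ⟨_ | _, _ | _ | _⟩ <;>
          simp_all [Literal.goal, Literal.can, Goal.toCmp, Goal.IsNegBinary]) (hholds v hv)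
    rw [hsubst] at hset
    rcases hset with hfact | ⟨e, s, t, hg, -⟩
    · exact hfact.proves (by simp)
    · obtain ⟨_, _, _, h₂⟩ := hgb
      simp [h₂] at hg

end Ground

/-! ## The query -/

section Query

variable {K : Type u} {R : Type v} {I : Type w}

/-- The frame in which the engine is invoked with the query `Q`. -/
def initialFrame (Q : List (Literal K R I)) : Frame K R I :=
  ⟨(Q.map Literal.goal).map fun g => (g, []), (litVars Q).map Term.var,
    varBound (Q.map Literal.goal)⟩

theorem mem_initialFrame_goals {Q : List (Literal K R I)}
    {ga : Goal CmpPred K R I × List (Goal CmpPred K R I)} :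
    ga ∈ (initialFrame Q).goals ↔ ∃ L ∈ Q, ga = (L.goal, []) := by
  simp [initialFrame, eq_comm]

theorem initialFrame_answer (Q : List (Literal K R I)) (η : Subst I) :
    (initialFrame Q).answer.map (Term.subst η) = (litVars Q).map η := by
  rw [initialFrame, List.map_map]
  rfl

theorem mem_litVars_subst_eq {Q : List (Literal K R I)} {θ η : Subst I}
    (h : ∀ x ∈ litVars Q, θ x = η x) {L : Literal K R I} (hL : L ∈ Q) :
    L.goal.subst θ = L.goal.subst η :=
  Goal.subst_congr fun x hx => h x (mem_litVars.2 ⟨L, hL, L.vars_goal ▸ hx⟩)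

theorem entailsConj_map_subst {S : Set (Clause K R I)} {Q : List (Literal K R I)} {σ : Subst I} :
    EntailsConj S (Q.map (Literal.subst σ)) ↔ ∀ L ∈ Q, ∀ M : Interp K R I, M.IsModel S →
      ∀ val : ℕ → M.Dom, M.GoalHolds val (L.goal.subst σ) := by
  constructor
  · intro h L hL M hM val
    rw [← Literal.goal_subst, Interp.goalHolds_goal]
    exact h M hM val _ (List.mem_map_of_mem hL)
  · intro h M hM val L' hL'
    obtain ⟨L, hL, rfl⟩ := List.mem_map.1 hL'
    rw [← Interp.goalHolds_goal, Literal.goal_subst]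
    exact h L hL M hM val

/-- Without negated concepts equivalent to `⊤` in the query, answers are ground. -/
theorem isGroundFor_of_entails {S : Set (Clause K R I)} (hred : InReducedForm S)
    (hcons : Consistent S) {Q : List (Literal K R I)} (hQ : IsConjunctiveQuery Q)
    (htop : NoNegatedTop S Q) {η : Subst I}
    (hent : ∀ L ∈ Q, ∀ M : Interp K R I, M.IsModel S →
      ∀ val : ℕ → M.Dom, M.GoalHolds val (L.goal.subst η))
    (hbin : ∀ L ∈ Q, L.IsBinary → ∀ x, x ∉ (L.goal.subst η).vars) : IsGroundFor Q η := by
  intro x hx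
  obtain ⟨L, hL, hx⟩ := mem_litVars.1 hx
  refine Term.exists_const_of_vars fun y hy => ?_
  by_cases hb : L.IsBinary
  · exact hbin L hL hb y (Goal.mem_vars_subst.2 ⟨x, L.vars_goal.symm ▸ hx, hy⟩)
  have hu := (hQ L hL).resolve_right fun h => hb h.1
  have hηx := Term.eq_var_of_mem_vars hy
  have hall := hent L hL
  obtain ⟨p, t, ht⟩ := hu
  obtain ⟨pos, atom⟩ := L
  obtain rfl : atom = .unary p t := ht
  obtain rfl : t = .var x :=
    Term.eq_var_of_mem_vars (by simpa [Literal.vars, Atom.args] using hx)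
  cases pos with
  | true =>
    refine hred.not_entails hcons p fun M hM val => ⟨_, List.mem_singleton_self _, ?_⟩
    have := hall M hM fun _ => val 0
    simpa [Literal.goal, Literal.can, Goal.toCmp, Goal.subst, Term.subst, hηx,
      Interp.GoalHolds, Interp.term, Interp.LitHolds, Interp.AtomHolds] using this
  | false =>
    refine htop p _ hL fun M hM val => ⟨_, List.mem_singleton_self _, ?_⟩
    have := hall M hM fun _ => val 0
    simpa [Literal.goal, Literal.can, Goal.toCmp, Goal.subst, Term.subst, hηx,
      Interp.GoalHolds, Interp.term, Interp.LitHolds, Interp.AtomHolds] using this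

variable [DecidableEq K] [DecidableEq R] [DecidableEq I]

/-- Query goals have no ancestors, so unary goals share their term with all ancestors vacuously. No
order of the conjuncts needs to be imposed. -/
theorem exists_admissibleList (Γ : Signature K R I) (B : ℕ) (c : Set ℕ)
    (gs : List (Goal CmpPred K R I)) (h : ∀ g ∈ gs, g.IsUnary ∨ g.IsBinary) :
    ∃ w, AdmissibleList Γ B c (gs.map fun g => (g, [])) w := by
  induction gs generalizing c with
  | nil => exact ⟨0, .nil c⟩
  | cons g gs ih =>
    obtain ⟨w, hw⟩ := ih (c ∪ binaryVars [g]) fun g hg => h g (List.mem_cons_of_mem _ hg)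
    obtain ⟨k, hk⟩ : ∃ k, Admissible Γ c g [] k := by
      rcases h g List.mem_cons_self with ⟨p, t, rfl⟩ | ⟨r, s, t, rfl⟩
      · exact ⟨_, .inr ⟨by simp, le_rfl⟩⟩
      · exact ⟨_, le_rfl⟩
    exact ⟨_, .cons hk hw⟩

theorem exists_admissible {S : Set (Clause K R I)} (hDL : ∀ C ∈ S, IsDLClause C)
    {Q : List (Literal K R I)} (hQ : IsConjunctiveQuery Q)
    {P : List (HornClause CmpPred K R I)} (hP : IsDLogProgram S P) :
    ∃ (Γ : Signature K R I) (B w : ℕ),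
      AdmissibleProgram Γ B P ∧ (initialFrame Q).Admissible Γ B w := by
  obtain ⟨Γ, hΓ⟩ :=
    exists_signature (Q.map Literal.goal ++ P.flatMap fun c => c.head :: c.body)
  obtain ⟨w, hw⟩ := exists_admissibleList Γ ((P.map fun c => c.body.length).sum + 1) ∅
    (Q.map Literal.goal) (by
      intro g hg
      obtain ⟨L, hL, rfl⟩ := List.mem_map.1 hg
      rw [Literal.isUnary_goal, Literal.isBinary_goal]
      exact (hQ L hL).imp_right And.left)
  refine ⟨Γ, (P.map fun c => c.body.length).sum + 1, w, ⟨Nat.succ_pos _, fun c hc => ?_⟩, hw,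
    fun ga hga => ?_, fun t ht => ?_⟩
  · refine ⟨hP.clauseShape hDL hc, Nat.lt_succ_of_le ?_, fun g hg => ?_⟩
    · exact List.le_sum_of_mem (List.mem_map.2 ⟨c, hc, rfl⟩)
    · exact hΓ g (List.mem_append_right _ (List.mem_flatMap.2 ⟨c, hc, hg⟩)) _
        fun x hx => lt_varBound hg hx
  · obtain ⟨L, hL, rfl⟩ := mem_initialFrame_goals.1 hga
    have hmem : L.goal ∈ Q.map Literal.goal := List.mem_map_of_mem hL
    exact ⟨hΓ _ (List.mem_append_left _ hmem) _ fun x hx => lt_varBound hmem hx, by simp⟩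
  · obtain ⟨x, hx, rfl⟩ := List.mem_map.1 ht
    obtain ⟨L, hL, hx⟩ := mem_litVars.1 hx
    exact lt_varBound (List.mem_map_of_mem hL) (L.vars_goal.symm ▸ hx)

end Query

end DLog

theorem mainTheorem1 {K : Type u} {R : Type v} {I : Type w}
    [DecidableEq K] [DecidableEq R] [DecidableEq I]
    (S : Set (Clause K R I)) (hfin : S.Finite) (hDL : ∀ C ∈ S, IsDLClause C)
    (hred : InReducedForm S) (hcons : Consistent S)
    (Q : List (Literal K R I)) (hQ : IsConjunctiveQuery Q)
    (P : List (HornClause CmpPred K R I)) (hP : IsDLogProgram S P) :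
    ∃ A : List (List (Term I)), TerminatesWith P Q A ∧
      (∀ σ : Subst I, IsGroundFor Q σ →
        (EntailsConj S (Q.map (Literal.subst σ)) ↔
          ∃ ts ∈ A, ∃ θ : Subst I, (litVars Q).map σ = ts.map (Term.subst θ))) ∧
      (NoNegatedTop S Q → ∀ ts : List (Term I), ts ∈ A ↔
        ∃ σ : Subst I, IsGroundFor Q σ ∧ ts = (litVars Q).map σ ∧
          EntailsConj S (Q.map (Literal.subst σ))) := by
  obtain ⟨Γ, B, w, hadm, hframe⟩ := exists_admissible hDL hQ hP
  obtain ⟨n, A, hrun, hA⟩ := hframe.run hadm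
  have hsound : ∀ ts ∈ A, ∃ η : Subst I, ts = (litVars Q).map η ∧
      (∀ L ∈ Q, ∀ M : Interp K R I, M.IsModel S →
        ∀ val : ℕ → M.Dom, M.GoalHolds val (L.goal.subst η)) ∧
      ∀ L ∈ Q, L.IsBinary → ∀ x, x ∉ (L.goal.subst η).vars := by
    intro ts hts
    obtain ⟨η, hη, hgoals⟩ := ((hA ts).1 hts).sound hadm hP hframe
    rw [initialFrame_answer] at hη
    refine ⟨η, hη, fun L hL M hM val => ?_, fun L hL hb => ?_⟩
    · simpa using (hgoals _ (mem_initialFrame_goals.2 ⟨L, hL, rfl⟩)).1 M hM val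
    · exact (hgoals _ (mem_initialFrame_goals.2 ⟨L, hL, rfl⟩)).2 (Literal.isBinary_goal.2 hb)
  have hcorrect : ∀ σ : Subst I, IsGroundFor Q σ →
      (EntailsConj S (Q.map (Literal.subst σ)) ↔
        ∃ ts ∈ A, ∃ θ : Subst I, (litVars Q).map σ = ts.map (Term.subst θ)) := by
    intro σ hσ
    constructor
    · intro hent
      obtain ⟨ts, hts, θ, hθ⟩ := hframe.exists_yields (δ := σ) hadm fun ga hga => by
        obtain ⟨L, hL, rfl⟩ := mem_initialFrame_goals.1 hga
        dsimp only
        rw [← Literal.goal_subst]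
        refine proves_of_entails hDL hcons hP ?_ (fun y hy => ?_) fun M hM val =>
          hent M hM val _ (List.mem_map_of_mem hL)
        · rcases hQ L hL with ⟨p, t, h⟩ | ⟨⟨r, s, t, h⟩, hpos⟩
          · exact .inl ⟨p, _, by rw [Literal.subst, h]; rfl⟩
          · exact .inr ⟨⟨r, _, _, by rw [Literal.subst, h]; rfl⟩, hpos⟩
        · rw [← Literal.vars_goal, Literal.goal_subst] at hy
          obtain ⟨x, hx, hy⟩ := Goal.mem_vars_subst.1 hy
          obtain ⟨a, ha⟩ := hσ x (mem_litVars.2 ⟨L, hL, L.vars_goal ▸ hx⟩)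
          simp [ha, Term.vars] at hy
      exact ⟨ts, (hA ts).2 hts, θ, (initialFrame_answer Q σ).symm.trans hθ⟩
    · rintro ⟨ts, hts, θ, hθ⟩
      -- The answer is entailed for all values of its remaining variables, hence so is its instance
      -- `σ`.
      obtain ⟨η, rfl, hη, -⟩ := hsound ts hts
      rw [List.map_map, List.map_inj_left] at hθ
      refine entailsConj_map_subst.2 fun L hL M hM val => ?_
      rw [mem_litVars_subst_eq hθ hL]
      change M.GoalHolds val (L.goal.subst fun x => (η x).subst θ)
      rw [← Goal.subst_subst, Interp.goalHolds_subst]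
      exact hη L hL M hM _
  refine ⟨A, ⟨n, hrun [] []⟩, hcorrect, fun htop ts => ⟨fun hts => ?_, ?_⟩⟩
  · obtain ⟨η, rfl, hη, hbin⟩ := hsound ts hts
    exact ⟨η, isGroundFor_of_entails hred hcons hQ htop hη hbin, rfl,
      entailsConj_map_subst.2 hη⟩
  · rintro ⟨σ, hσ, rfl, hent⟩
    obtain ⟨ts, hts, θ, hθ⟩ := (hcorrect σ hσ).1 hent
    obtain ⟨η, rfl, hη, hbin⟩ := hsound ts hts
    have hground := isGroundFor_of_entails hred hcons hQ htop hη hbin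
    -- The answer found is ground, so its instance `σ` coincides with it.
    have : (litVars Q).map σ = (litVars Q).map η := by
      rw [hθ, List.map_map]
      refine List.map_congr_left fun x hx => ?_
      obtain ⟨a, ha⟩ := hground x hx
      simp [ha, Term.subst]
    rwa [this]
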